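/- For $\tau\in\mathbb{C}$ with $v:=\operatorname{Im}\tau>0$, let $q^x:=e^{2\pi i\tau x}$ for $x\in\mathbb{R}$ (so $q=e^{2\pi i\tau}$), let $\zeta_N:=e^{2\pi i/N}$, and let $\Gamma(a,y):=\int_y^\infty e^{-t}t^{a-1}\,dt$ for $y>0$. Define \[ H(q):=\sum_{n\ge 0}(-1)^nq^{3n^2+2n}\left(1+q^{2n+1}\right)\sum_{|j|\le n}(-1)^{j}q^{-j^2}, \] \[ H^{-}(\tau):=-\frac{1}{\sqrt{\pi}}\sum_{\varepsilon\in\{0,1\}}(-1)^{\varepsilon}\sum_{n,r\in\mathbb{Z}}\operatorname{sgn}\left(2r+\varepsilon+\tfrac13\right)\Gamma\left(\tfrac12,6\pi\left(2r+\varepsilon+\tfrac13\right)^2v\right)q^{-\frac32\left(2r+\varepsilon+\frac13\right)^2+\frac12\left(2n+\varepsilon+1\right)^2}, \] and $\widehat H(\tau):=q^{1/3}H(q)+H^{-}(\tau)$. Then, for every $\tau$ with $\operatorname{Im}\tau>0$, the series over $n\ge0$ defining $H(q)$ and the two series over $(n,r)\in\mathbb{Z}^2$ defining $H^-(\tau)$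 converge absolutely, and \[ \widehat H(\tau+1)=\zeta_3\,\widehat H(\tau),\qquad \widehat H\left(\frac{\tau}{2\tau+1}\right)=\zeta_{12}\,(2\tau+1)\,\widehat H(\tau). \] -/

import Mathlib

noncomputable section

namespace HeckeCompletion

/-- The root of unity `ζ_N = e^{2πi/N}`. -/
def zeta (N : ℕ) : ℂ := Complex.exp (2 * Real.pi * Complex.I / N)

/-- The power `q^x` for a real exponent `x`, where `q = e^{2πiτ}`; that is, `e^{2πiτx}`. -/
def qPow (τ : ℂ) (x : ℝ) : ℂ := Complex.exp (2 * Real.pi * Complex.I * τ * x)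

/-- The (upper) incomplete gamma function `Γ(a, v) = ∫_v^∞ e^{-t} t^{a-1} dt` for `v > 0`. -/
def incGamma (a v : ℝ) : ℝ := ∫ t in Set.Ioi v, Real.exp (-t) * t ^ (a - 1)

/-- The `n`-th summand of the Hecke-type series,
`(-1)^n q^{3n²+2n} (1 + q^{2n+1}) ∑_{|j| ≤ n} (-1)^j q^{-j²}`. -/
def heckeTerm (q : ℂ) (n : ℕ) : ℂ :=
  (-1) ^ n * q ^ (3 * n ^ 2 + 2 * n) * (1 + q ^ (2 * n + 1)) *
    ∑ j ∈ Finset.Icc (-(n : ℤ)) (n : ℤ), (-1 : ℂ) ^ j * q ^ (-(j ^ 2))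

/-- The Hecke-type double sum `H(q)`. -/
def heckeH (q : ℂ) : ℂ := ∑' n : ℕ, heckeTerm q n

/-- The summand of the non-holomorphic part for `ε ∈ {0, 1}` and `(n, r) ∈ ℤ²`:
`sgn(2r+ε+1/3) Γ(1/2, 6π(2r+ε+1/3)² v) q^{-(3/2)(2r+ε+1/3)² + (1/2)(2n+ε+1)²}`, `v = Im τ`. -/
def minusTerm (τ : ℂ) (ε : ℕ) (p : ℤ × ℤ) : ℂ :=
  ((Real.sign (2 * p.2 + ε + 1 / 3) *
      incGamma (1 / 2) (6 * Real.pi * (2 * p.2 + ε + 1 / 3) ^ 2 * τ.im) : ℝ) : ℂ) *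
    qPow τ (-(3 / 2) * (2 * p.2 + ε + 1 / 3) ^ 2 + 1 / 2 * (2 * p.1 + ε + 1) ^ 2)

/-- The non-holomorphic part `H⁻(τ)`. -/
def Hminus (τ : ℂ) : ℂ :=
  -((1 / Real.sqrt Real.pi : ℝ) : ℂ) *
    ∑ ε ∈ Finset.range 2, (-1) ^ ε * ∑' p : ℤ × ℤ, minusTerm τ ε p

/-- The completion `Ĥ(τ) = q^{1/3} H(q) + H⁻(τ)`, with `q = e^{2πiτ}`. -/
def Hhat (τ : ℂ) : ℂ := qPow τ (1 / 3) * heckeH (qPow τ 1) + Hminus τ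

end HeckeCompletion

end

noncomputable section

namespace HeckeCompletion

open Complex Real ComplexConjugate MeasureTheory

/-! ### One-dimensional theta series with a linear factor -/

/-! The completion is a boost integral of a Siegel theta series: `Hhat_eq_integral` writes `Hhat τ`
as `2√v` times the integral of `siegelTheta τ s` over `|s| ≤ boostEnd`, where `v = Im τ`. The series
belongs to the form `3x² - y²` on `(ℤ + 1/3) × ℤ`, and `s` parametrizes the splitting of the plane
into a positive and a negative line.

The kernel is `q^(3x² - y²) p e^(-4πv m²)`, with `p`, `m` the boosted coordinates
(`siegelKernel_eq`). Since `∂m/∂s = -p`, it is an exact derivative in `s`, and its integral is a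
difference of Gaussian primitives at the endpoints. There `m` is proportional to `x - y` and `x +
y`, so each lattice point contributes completed signs of `x + y` and `x - y`
(`two_sqrt_mul_integral_siegelKernel`). The plain signs cut out the cone `|y| < |x|`, whose sum is
`q^(1/3) H(q)`; the incomplete gamma corrections add up to `Hminus` (`hasSum_coneTerm`,
`hasSum_heckeTerm`).

Modularity is then checked for the theta series at each fixed `s`. Translation by one multiplies
every summand by `zeta 3`. For the other map, `τ/(2τ+1) = -1/(-1/τ - 2)`: Poisson summation gives
the inversion (`siegelTheta_neg_one_div`), and the dual series is an eigenfunction of `τ ↦ τ - 2`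
(`siegelThetaDual_sub_two`). The resulting factor `(2τ+1)|2τ+1|` loses its absolute value to the
change of `√v`, leaving weight one. -/

lemma hasSum_linear_mul_jacobiTheta₂_term (α β w : ℂ) {a : ℂ} (ha : 0 < a.im) :
    HasSum (fun n : ℤ ↦ (α * n + β) * jacobiTheta₂_term n w a)
      (α / (2 * π * I) * jacobiTheta₂' w a + β * jacobiTheta₂ w a) := by
  have h1 := (hasSum_jacobiTheta₂'_term w ha).mul_left (α / (2 * π * I))
  have h2 := (hasSum_jacobiTheta₂_term w ha).mul_left β
  refine Eq.mp (congrArg (HasSum · _) (funext fun n ↦ ?_)) (h1.add h2)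
  have := two_pi_I_ne_zero
  simp only [jacobiTheta₂'_term]
  field_simp

lemma gaussian_shift_eq (a z h : ℂ) (n : ℤ) :
    cexp (π * I * a * (n + h) ^ 2 + 2 * π * I * (n + h) * z) =
      cexp (π * I * a * h ^ 2 + 2 * π * I * h * z) * jacobiTheta₂_term n (z + a * h) a := by
  rw [jacobiTheta₂_term, ← Complex.exp_add]
  ring_nf

lemma gaussian_dual_eq {a : ℂ} (ha : a ≠ 0) (z h : ℂ) (k : ℤ) :
    cexp (-(π * I * (k - z) ^ 2 / a) + 2 * π * I * k * h) =
      cexp (-π * I * z ^ 2 / a) * jacobiTheta₂_term k ((z + a * h) / a) (-1 / a) := by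
  rw [jacobiTheta₂_term, ← Complex.exp_add]
  congr 1
  field_simp
  ring

/-- Summability of a linear polynomial times a shifted Gaussian over `ℤ`. -/
lemma summable_linear_mul_gaussian {a : ℂ} (ha : 0 < a.im) (z α β h : ℂ) :
    Summable fun n : ℤ ↦ (α * (n + h) + β) *
      cexp (π * I * a * (n + h) ^ 2 + 2 * π * I * (n + h) * z) := by
  have := (hasSum_linear_mul_jacobiTheta₂_term α (α * h + β) (z + a * h) ha).summable.mul_left
    (cexp (π * I * a * h ^ 2 + 2 * π * I * h * z))
  refine this.congr fun n ↦ ?_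
  rw [gaussian_shift_eq]
  ring

lemma im_neg_one_div_pos {a : ℂ} (ha : 0 < a.im) : 0 < (-1 / a).im := by
  have ha0 : a ≠ 0 := fun h0 ↦ by simp [h0] at ha
  have : 0 < normSq a := normSq_pos.mpr ha0
  rw [neg_div, neg_im, one_div, inv_im, neg_div, neg_neg]
  positivity

/-- Poisson summation for a linear polynomial times a Gaussian. -/
lemma tsum_linear_mul_gaussian {a : ℂ} (ha : 0 < a.im) (z α β h : ℂ) :
    ∑' n : ℤ, (α * (n + h) + β) * cexp (π * I * a * (n + h) ^ 2 + 2 * π * I * (n + h) * z) =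
      1 / (-I * a) ^ (1 / 2 : ℂ) * ∑' k : ℤ, (α * (k - z) / a + β) *
        cexp (-(π * I * (k - z) ^ 2 / a) + 2 * π * I * k * h) := by
  have ha0 : a ≠ 0 := fun h0 ↦ by simp [h0] at ha
  have ha' := im_neg_one_div_pos ha
  have hpi := two_pi_I_ne_zero
  have h1 := (hasSum_linear_mul_jacobiTheta₂_term α (α * h + β) (z + a * h) ha).mul_left
    (cexp (π * I * a * h ^ 2 + 2 * π * I * h * z))
  have h2 := (hasSum_linear_mul_jacobiTheta₂_term (α / a) (β - α * z / a)
    ((z + a * h) / a) ha').mul_left (cexp (-π * I * z ^ 2 / a))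
  rw [tsum_congr (fun n ↦ ?_), h1.tsum_eq, tsum_congr (fun k ↦ ?_), h2.tsum_eq]
  rotate_left
  · rw [gaussian_dual_eq ha0]; ring
  · rw [gaussian_shift_eq]; ring
  rw [jacobiTheta₂_functional_equation, jacobiTheta₂'_functional_equation]
  have e : cexp (-π * I * z ^ 2 / a) = cexp (π * I * a * h ^ 2 + 2 * π * I * h * z) *
      cexp (-π * I * (z + a * h) ^ 2 / a) := by
    rw [← Complex.exp_add]
    congr 1
    field_simp
    ring
  rw [e]
  field_simp
  ring

/-! ### Summability over `ℤ × ℤ` -/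

lemma summable_one_add_abs_mul_exp_neg_sq {δ : ℝ} (hδ : 0 < δ) (c h : ℝ) (hc : 0 < c) :
    Summable fun n : ℤ ↦ (1 + |c * (n + h)|) * Real.exp (-δ * (c * (n + h)) ^ 2) := by
  have ha : 0 < (((δ * c ^ 2 / π : ℝ) : ℂ) * I).im := by
    simp only [mul_im, ofReal_re, I_im, mul_one, ofReal_im, I_re, mul_zero, add_zero]
    positivity
  have h1 := (summable_linear_mul_gaussian ha 0 0 1 h).norm
  have h2 := (summable_linear_mul_gaussian ha 0 c 0 h).norm
  refine (h1.add h2).congr fun n ↦ ?_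
  have e : cexp (π * I * (((δ * c ^ 2 / π : ℝ) : ℂ) * I) * (n + h) ^ 2 + 2 * π * I * (n + h) * 0)
      = ((Real.exp (-δ * (c * (n + h)) ^ 2) : ℝ) : ℂ) := by
    rw [ofReal_exp]
    congr 1
    push_cast
    have : (π : ℂ) ≠ 0 := by exact_mod_cast pi_ne_zero
    field_simp
    linear_combination (δ * c ^ 2 * (n + h) ^ 2 : ℂ) * I_sq
  rw [e, zero_mul, zero_add, add_zero, norm_mul, norm_mul, norm_one,
    Complex.norm_of_nonneg (Real.exp_pos _).le]
  have : ((c : ℂ) * (n + h)) = ((c * (n + h) : ℝ) : ℂ) := by push_cast; rfl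
  rw [this, Complex.norm_real, Real.norm_eq_abs]
  ring

lemma summable_exp_neg_sq_add_sq {δ : ℝ} (hδ : 0 < δ) {c d : ℝ} (hc : 0 < c) (hd : 0 < d)
    (g h : ℝ) :
    Summable fun p : ℤ × ℤ ↦ (1 + |c * (p.1 + g)|) * (1 + |d * (p.2 + h)|) *
      Real.exp (-δ * ((c * (p.1 + g)) ^ 2 + (d * (p.2 + h)) ^ 2)) := by
  have := (summable_one_add_abs_mul_exp_neg_sq hδ c g hc).mul_of_nonneg
    (summable_one_add_abs_mul_exp_neg_sq hδ d h hd) (fun _ ↦ by positivity) (fun _ ↦ by positivity)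
  refine this.congr fun p ↦ ?_
  rw [mul_add (-δ), Real.exp_add]
  ring

/-- A function on a lattice bounded by a linear polynomial times a Gaussian is summable. -/
lemma summable_of_norm_le_gaussian {δ C c d g h : ℝ} (hδ : 0 < δ) (hc : 0 < c) (hd : 0 < d)
    {f : ℤ × ℤ → ℂ} (hf : ∀ p : ℤ × ℤ, ‖f p‖ ≤ C * ((1 + |c * (p.1 + g)|) * (1 + |d * (p.2 + h)|)) *
      Real.exp (-δ * ((c * (p.1 + g)) ^ 2 + (d * (p.2 + h)) ^ 2))) : Summable f := by
  refine Summable.of_norm_bounded ((summable_exp_neg_sq_add_sq hδ hc hd g h).mul_left C) fun p ↦ ?_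
  rw [← mul_assoc]
  exact hf p

/-- Determinant over trace is a lower bound for the smallest eigenvalue. After multiplication by the
trace, the difference of the two sides is `(αx + βy)² + (βx + γy)²`. -/
lemma sq_add_sq_le_quadraticForm {α β γ : ℝ} (hα : 0 < α) (h : β ^ 2 < α * γ) (x y : ℝ) :
    (α * γ - β ^ 2) / (α + γ) * (x ^ 2 + y ^ 2) ≤ α * x ^ 2 + 2 * β * x * y + γ * y ^ 2 := by
  have hγ : 0 < γ := pos_of_mul_pos_right ((sq_nonneg β).trans_lt h) hα.le
  rw [div_mul_eq_mul_div, div_le_iff₀ (by positivity)]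
  nlinarith [sq_nonneg (α * x + β * y), sq_nonneg (β * x + γ * y)]

lemma norm_linear_le (A B : ℂ) (x y : ℝ) :
    ‖A * x + B * y‖ ≤ (‖A‖ + ‖B‖) * ((1 + |x|) * (1 + |y|)) := by
  refine (norm_add_le _ _).trans ?_
  rw [norm_mul, norm_mul, Complex.norm_real, Complex.norm_real, Real.norm_eq_abs, Real.norm_eq_abs,
    add_mul]
  gcongr <;> nlinarith [abs_nonneg x, abs_nonneg y, mul_nonneg (abs_nonneg x) (abs_nonneg y)]

/-- A linear form times a Gaussian with definite real part is summable over a shifted lattice. -/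
lemma summable_linear_mul_exp {α β γ : ℝ} (hα : 0 < α) (h : β ^ 2 < α * γ) {c d : ℝ} (hc : 0 < c)
    (hd : 0 < d) (g k : ℝ) (A B : ℂ) {E : ℤ × ℤ → ℂ}
    (hE : ∀ p, (E p).re = -(α * (c * (p.1 + g)) ^ 2 + 2 * β * (c * (p.1 + g)) * (d * (p.2 + k)) +
      γ * (d * (p.2 + k)) ^ 2)) :
    Summable fun p : ℤ × ℤ ↦
      (A * (c * (p.1 + g) : ℝ) + B * (d * (p.2 + k) : ℝ)) * cexp (E p) := by
  have hγ : 0 < γ := pos_of_mul_pos_right ((sq_nonneg β).trans_lt h) hα.le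
  have hδ : 0 < (α * γ - β ^ 2) / (α + γ) := div_pos (by linarith) (by linarith)
  refine summable_of_norm_le_gaussian hδ hc hd (C := ‖A‖ + ‖B‖) (g := g) (h := k) fun p ↦ ?_
  rw [norm_mul, Complex.norm_exp, hE]
  refine mul_le_mul (norm_linear_le _ _ _ _) ?_ (Real.exp_pos _).le (by positivity)
  rw [Real.exp_le_exp, neg_mul]
  exact neg_le_neg (sq_add_sq_le_quadraticForm hα h _ _)

/-! ### Two-dimensional Poisson summation for Gaussians -/

/-- No branch ambiguity arises: `y` is a positive multiple of `x⁻¹`, and `x` lies in the right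
half-plane, away from the cut. -/
lemma cpow_half_mul_cpow_half {x y : ℂ} {r : ℝ} (hx : 0 < x.re) (hr : 0 < r)
    (h : x * y = (r : ℂ) ^ 2) : x ^ (1 / 2 : ℂ) * y ^ (1 / 2 : ℂ) = r := by
  have hx0 : x ≠ 0 := fun h0 ↦ by simp [h0] at hx
  have hy : y = ((r ^ 2 : ℝ) : ℂ) * x⁻¹ := by
    push_cast
    rw [← h]
    field_simp
  have harg : x.arg ≠ π := fun h0 ↦ by
    rw [arg_eq_pi_iff] at h0
    linarith [h0.1]
  have hr2 : ((r ^ 2 : ℝ) : ℂ) ^ (1 / 2 : ℂ) = r := by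
    have h2 : (1 / 2 : ℂ) = ((1 / 2 : ℝ) : ℂ) := by push_cast; rfl
    rw [h2, ← ofReal_cpow (sq_nonneg r), ← Real.sqrt_eq_rpow, Real.sqrt_sq hr.le]
  have hmul : (((r ^ 2 : ℝ) : ℂ) * x⁻¹) ^ (1 / 2 : ℂ) =
      ((r ^ 2 : ℝ) : ℂ) ^ (1 / 2 : ℂ) * x⁻¹ ^ (1 / 2 : ℂ) := by
    have hr0 : ((r ^ 2 : ℝ) : ℂ) ≠ 0 := by exact_mod_cast (pow_pos hr 2).ne'
    rw [cpow_def_of_ne_zero (mul_ne_zero hr0 (inv_ne_zero hx0)), cpow_def_of_ne_zero hr0,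
      cpow_def_of_ne_zero (inv_ne_zero hx0), log_ofReal_mul (pow_pos hr 2) (inv_ne_zero hx0),
      ofReal_log (sq_nonneg r), add_mul, Complex.exp_add]
  rw [hy, hmul, inv_cpow _ _ harg, hr2]
  have : x ^ (1 / 2 : ℂ) ≠ 0 := by simp [hx0]
  field_simp

section Poisson

variable {a b c : ℂ}

/-- Poisson summation in one variable replaces the form `(a, b, c)` by one with coefficients `-1/a`,
`b/a`, `c - b²/a`. The discriminant of the imaginary part is only rescaled by a positive factor, so
the intermediate sum still converges absolutely. -/
lemma im_partial_dual_form (ha0 : a ≠ 0) :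
    (-1 / a).im * (c - b ^ 2 / a).im - (b / a).im ^ 2 =
      (a.im * c.im - b.im ^ 2) / normSq a := by
  have hn : normSq a ≠ 0 := normSq_eq_zero.not.mpr ha0
  simp only [div_im, sub_im, neg_im, neg_re, one_im, one_re, pow_two, mul_im, mul_re]
  field_simp
  rw [normSq_apply]
  ring

lemma sq_im_lt_partial_dual (ha : 0 < a.im) (hD : b.im ^ 2 < a.im * c.im) :
    (b / a).im ^ 2 < (-1 / a).im * (c - b ^ 2 / a).im := by
  have ha0 : a ≠ 0 := fun h0 ↦ by simp [h0] at ha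
  rw [← sub_pos, im_partial_dual_form ha0]
  exact div_pos (sub_pos.mpr hD) (normSq_pos.mpr ha0)

/-- Summability of a linear form times a Gaussian on the plane. -/
lemma summable_gaussian_two (ha : 0 < a.im) (hD : b.im ^ 2 < a.im * c.im) (h : ℝ) (A B : ℂ) :
    Summable fun p : ℤ × ℤ ↦ (A * (p.1 + h) + B * p.2) *
      cexp (π * I * (a * (p.1 + h) ^ 2 + 2 * b * (p.1 + h) * p.2 + c * p.2 ^ 2)
        + π * I * (p.1 + h) + π * I * p.2) := by
  have hα : 0 < π * a.im := by positivity
  have hD' : (π * b.im) ^ 2 < (π * a.im) * (π * c.im) := by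
    nlinarith [mul_pos pi_pos pi_pos]
  refine (summable_linear_mul_exp hα hD' one_pos one_pos h 0 A B
    (E := fun p ↦ π * I * (a * (p.1 + h) ^ 2 + 2 * b * (p.1 + h) * p.2 + c * p.2 ^ 2)
      + π * I * (p.1 + h) + π * I * p.2) fun p ↦ ?_).congr fun p ↦ ?_
  · simp [pow_two]
    ring
  · push_cast
    ring_nf

/-- Summability of the Fourier transform in one variable of a Gaussian on the plane. -/
lemma summable_gaussian_partial_dual (ha : 0 < a.im) (hD : b.im ^ 2 < a.im * c.im) (h : ℝ)
    (A B : ℂ) :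
    Summable fun p : ℤ × ℤ ↦ (A * (p.1 - (b * p.2 + 1 / 2)) / a + B * p.2) *
      cexp (-(π * I * (p.1 - (b * p.2 + 1 / 2)) ^ 2 / a) + 2 * π * I * p.1 * h +
        (π * I * c * p.2 ^ 2 + π * I * p.2)) := by
  have ha0 : a ≠ 0 := fun h0 ↦ by simp [h0] at ha
  have hα : 0 < π * (-1 / a).im := mul_pos pi_pos (im_neg_one_div_pos ha)
  have hD' : (π * (b / a).im) ^ 2 < (π * (-1 / a).im) * (π * (c - b ^ 2 / a).im) := by
    nlinarith [mul_pos pi_pos pi_pos, sq_im_lt_partial_dual ha hD]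
  refine (summable_linear_mul_exp hα hD' one_pos one_pos (-(1 / 2)) 0 (A / a) (B - A * b / a)
    (E := fun p ↦ -(π * I * (p.1 - (b * p.2 + 1 / 2)) ^ 2 / a) + 2 * π * I * p.1 * h +
      (π * I * c * p.2 ^ 2 + π * I * p.2)) fun p ↦ ?_).congr fun p ↦ ?_
  · have : -(π * I * (p.1 - (b * p.2 + 1 / 2)) ^ 2 / a) + 2 * π * I * p.1 * h +
        (π * I * c * p.2 ^ 2 + π * I * p.2) =
        I * (((π * (p.1 - 1 / 2) ^ 2 : ℝ) : ℂ) * (-1 / a) +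
          ((2 * π * (p.1 - 1 / 2) * p.2 : ℝ) : ℂ) * (b / a) +
          ((π * p.2 ^ 2 : ℝ) : ℂ) * (c - b ^ 2 / a) + ((2 * π * p.1 * h + π * p.2 : ℝ) : ℂ)) := by
      push_cast
      field_simp
      ring
    simp only [this, I_mul_re, add_im, im_ofReal_mul, ofReal_im]
    ring
  · congr 1
    push_cast
    field_simp
    ring

lemma tsum_gaussian_two_fst (ha : 0 < a.im) (h : ℝ) (A B : ℂ) (j : ℤ) :
    ∑' n : ℤ, (A * (n + h) + B * j) *
      cexp (π * I * (a * (n + h) ^ 2 + 2 * b * (n + h) * j + c * j ^ 2)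
        + π * I * (n + h) + π * I * j) =
      1 / (-I * a) ^ (1 / 2 : ℂ) * ∑' k : ℤ, (A * (k - (b * j + 1 / 2)) / a + B * j) *
      cexp (-(π * I * (k - (b * j + 1 / 2)) ^ 2 / a) + 2 * π * I * k * h +
        (π * I * c * j ^ 2 + π * I * j)) := by
  have := tsum_linear_mul_gaussian ha (b * j + 1 / 2) A (B * j) h
  simp_rw [Complex.exp_add _ (π * I * c * j ^ 2 + π * I * j), ← mul_assoc _ (cexp _) (cexp _)]
  rw [tsum_mul_right, ← mul_assoc, ← this, ← tsum_mul_right]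
  refine tsum_congr fun n ↦ ?_
  rw [mul_assoc (_ + _), ← Complex.exp_add]
  ring_nf

/-- Completing the square makes the `j`-sum one-dimensional with quadratic coefficient the Schur
complement `w`. Its linear term carries `(k - 1/2) b / a` from the first transform and `1/2` from
the sign twist. -/
lemma tsum_gaussian_two_snd {w : ℂ} (ha : a ≠ 0) (hw : 0 < w.im) (h : ℝ) (A B : ℂ) (k : ℤ) :
    ∑' j : ℤ, (A * (k - (b * j + 1 / 2)) / a + B * j) *
      cexp (-(π * I * (k - (b * j + 1 / 2)) ^ 2 / a) + 2 * π * I * k * h +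
        (π * I * (w + b ^ 2 / a) * j ^ 2 + π * I * j)) =
      1 / (-I * w) ^ (1 / 2 : ℂ) * ∑' l : ℤ,
      ((B * a - A * b) * (l - 1 / 2) + (A * (w + b ^ 2 / a) - B * b) * (k - 1 / 2)) / (a * w) *
      cexp (-(π * I * (a * (l - 1 / 2) ^ 2 - 2 * b * (l - 1 / 2) * (k - 1 / 2) +
        (w + b ^ 2 / a) * (k - 1 / 2) ^ 2) / (a * w)) + 2 * π * I * k * h) := by
  have hw0 : w ≠ 0 := fun h0 ↦ by simp [h0] at hw
  have := tsum_linear_mul_gaussian hw ((k - 1 / 2) * b / a + 1 / 2) (B - A * b / a)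
    (A * (k - 1 / 2) / a) 0
  rw [tsum_congr (g := fun j : ℤ ↦ cexp (-(π * I * (k - 1 / 2) ^ 2 / a) + 2 * π * I * k * h) *
    (((B - A * b / a) * (j + 0) + A * (k - 1 / 2) / a) * cexp (π * I * w * (j + 0) ^ 2 +
      2 * π * I * (j + 0) * ((k - 1 / 2) * b / a + 1 / 2)))) fun j ↦ ?_,
    tsum_mul_left, this, mul_left_comm, ← tsum_mul_left]
  · congr 1
    refine tsum_congr fun l ↦ ?_
    rw [mul_left_comm, ← Complex.exp_add]
    congr 1
    · field_simp
      ring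
    · congr 1
      field_simp
      ring
  · rw [mul_left_comm, ← Complex.exp_add]
    congr 1
    · field_simp
      ring
    · congr 1
      field_simp
      ring

/-- Poisson summation over `ℤ²` for a linear form times a Gaussian. -/
lemma tsum_gaussian_two (ha : 0 < a.im) (hD : b.im ^ 2 < a.im * c.im) {r : ℝ} (hr : 0 < r)
    (hdet : a * c - b ^ 2 = -(r : ℂ) ^ 2) (h : ℝ) (A B : ℂ) :
    ∑' p : ℤ × ℤ, (A * (p.1 + h) + B * p.2) *
      cexp (π * I * (a * (p.1 + h) ^ 2 + 2 * b * (p.1 + h) * p.2 + c * p.2 ^ 2)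
        + π * I * (p.1 + h) + π * I * p.2) =
    1 / r * ∑' k : ℤ, ∑' l : ℤ,
      ((A * b - B * a) * (l - 1 / 2) + (B * b - A * c) * (k - 1 / 2)) / r ^ 2 *
      cexp (π * I * (a * (l - 1 / 2) ^ 2 - 2 * b * (l - 1 / 2) * (k - 1 / 2) +
        c * (k - 1 / 2) ^ 2) / r ^ 2 + 2 * π * I * k * h) := by
  have ha0 : a ≠ 0 := fun h0 ↦ by simp [h0] at ha
  have hr0 : (r : ℂ) ≠ 0 := by exact_mod_cast hr.ne'
  have hα := im_neg_one_div_pos ha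
  have hD' := sq_im_lt_partial_dual ha hD
  have ha' : 0 < (c - b ^ 2 / a).im := pos_of_mul_pos_right ((sq_nonneg _).trans_lt hD') hα.le
  have ha'0 : c - b ^ 2 / a ≠ 0 := fun h0 ↦ by simp [h0] at ha'
  have haa' : a * (c - b ^ 2 / a) = -(r : ℂ) ^ 2 := by
    rw [← hdet]
    field_simp
  have hf := summable_gaussian_two ha hD h A B
  have hg := summable_gaussian_partial_dual ha hD h A B
  have hcp : (-I * a) ^ (1 / 2 : ℂ) * (-I * (c - b ^ 2 / a)) ^ (1 / 2 : ℂ) = r := by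
    refine cpow_half_mul_cpow_half (by simpa using ha) hr ?_
    linear_combination (-1 : ℂ) * haa' + a * (c - b ^ 2 / a) * I_sq
  have hca : c - b ^ 2 / a + b ^ 2 / a = c := by ring
  -- Transform in the first variable, exchange the order of summation, then transform in the second.
  -- Both exchanges rest on the absolute convergence in `hf` and `hg`.
  have e1 := hf.tsum_prod
  have e2 := Summable.tsum_comm (f := fun n j : ℤ ↦ (A * (n + h) + B * j) *
      cexp (π * I * (a * (n + h) ^ 2 + 2 * b * (n + h) * j + c * j ^ 2)
        + π * I * (n + h) + π * I * j)) hf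
  have e3 := Summable.tsum_comm (f := fun k j : ℤ ↦ (A * (k - (b * j + 1 / 2)) / a + B * j) *
      cexp (-(π * I * (k - (b * j + 1 / 2)) ^ 2 / a) + 2 * π * I * k * h +
        (π * I * c * j ^ 2 + π * I * j))) hg
  have e4 := fun k ↦ tsum_gaussian_two_snd (b := b) ha0 ha' h A B k
  simp only [hca] at e4
  rw [e1, ← e2, tsum_congr fun j ↦ tsum_gaussian_two_fst ha h A B j, tsum_mul_left, e3,
    tsum_congr e4, tsum_mul_left, ← mul_assoc, one_div_mul_one_div, hcp]
  congr 1
  refine tsum_congr fun k ↦ tsum_congr fun l ↦ ?_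
  rw [haa']
  congr 1
  · field_simp
    ring
  · congr 1
    field_simp

end Poisson

/-! ### Siegel theta series of the form `3x² - y²` -/

/-- The positive coordinate of `(x, y)` for the form `3x² - y²`, rotated by the boost `s`. -/
def boostPos (s x y : ℝ) : ℝ := √3 * x * Real.cosh s - y * Real.sinh s

/-- The negative coordinate of `(x, y)` for the form `3x² - y²`, rotated by the boost `s`. -/
def boostNeg (s x y : ℝ) : ℝ := y * Real.cosh s - √3 * x * Real.sinh s

/-- The summand of the Siegel theta series of weight `(3/2, 1/2)` attached to `3x² - y²`. -/
def siegelKernel (τ : ℂ) (s x y : ℝ) : ℂ :=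
  boostPos s x y * cexp (2 * π * I * (τ * boostPos s x y ^ 2 - conj τ * boostNeg s x y ^ 2))

/-- The Siegel theta series on `(ℤ + 1/3) × ℤ` twisted by `(-1)^{n+j}`. -/
def siegelTheta (τ : ℂ) (s : ℝ) : ℂ :=
  ∑' p : ℤ × ℤ, (-1) ^ (p.1 + p.2) * siegelKernel τ s (p.1 + 1 / 3) p.2

/-- The Siegel theta series dual to `siegelTheta`. -/
def siegelThetaDual (τ : ℂ) (s : ℝ) : ℂ :=
  ∑' p : ℤ × ℤ, cexp (2 * π * I * p.1 / 3) *
    siegelKernel τ s (1 / 6 * (p.1 + -(1 / 2))) (1 / 2 * (p.2 + -(1 / 2)))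

lemma boostPos_sq_sub_boostNeg_sq (s x y : ℝ) :
    boostPos s x y ^ 2 - boostNeg s x y ^ 2 = 3 * x ^ 2 - y ^ 2 := by
  have h3 : √3 ^ 2 = 3 := Real.sq_sqrt (by norm_num)
  have hc := Real.cosh_sq' s
  simp only [boostPos, boostNeg]
  linear_combination (√3 ^ 2 * x ^ 2 - y ^ 2) * hc + x ^ 2 * h3

lemma neg_one_zpow_eq_cexp (n : ℤ) : (-1 : ℂ) ^ n = cexp (π * I * n) := by
  rw [mul_comm, Complex.exp_int_mul, Complex.exp_pi_mul_I]

lemma re_two_pi_I_mul_sub_conj (τ : ℂ) (p m : ℝ) :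
    (2 * π * I * (τ * p ^ 2 - conj τ * m ^ 2)).re = -(2 * π * τ.im * (p ^ 2 + m ^ 2)) := by
  simp [pow_two]
  ring

lemma norm_siegelKernel (τ : ℂ) (s x y : ℝ) :
    ‖siegelKernel τ s x y‖ =
      |boostPos s x y| * Real.exp (-(2 * π * τ.im * (boostPos s x y ^ 2 + boostNeg s x y ^ 2))) := by
  rw [siegelKernel, norm_mul, Complex.norm_exp, Complex.norm_real, Real.norm_eq_abs,
    re_two_pi_I_mul_sub_conj]

lemma summable_siegelKernel {τ : ℂ} (hτ : 0 < τ.im) (s : ℝ) {c d : ℝ} (hc : 0 < c) (hd : 0 < d)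
    (g k : ℝ) :
    Summable fun p : ℤ × ℤ ↦ siegelKernel τ s (c * (p.1 + g)) (d * (p.2 + k)) := by
  have h3 : √3 ^ 2 = 3 := Real.sq_sqrt (by norm_num)
  have hch := Real.cosh_sq' s
  have hα : 0 < 6 * π * τ.im * (Real.cosh s ^ 2 + Real.sinh s ^ 2) := by
    have := Real.cosh_pos s
    positivity
  have hD : (-(4 * √3 * π * τ.im * Real.cosh s * Real.sinh s)) ^ 2 <
      6 * π * τ.im * (Real.cosh s ^ 2 + Real.sinh s ^ 2) *
        (2 * π * τ.im * (Real.cosh s ^ 2 + Real.sinh s ^ 2)) := by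
    have h12 : 0 < 12 * (π * τ.im) ^ 2 := by positivity
    -- The discriminant does not depend on `s`, because a boost has determinant one.
    have : 6 * π * τ.im * (Real.cosh s ^ 2 + Real.sinh s ^ 2) *
        (2 * π * τ.im * (Real.cosh s ^ 2 + Real.sinh s ^ 2)) -
        (-(4 * √3 * π * τ.im * Real.cosh s * Real.sinh s)) ^ 2 = 12 * (π * τ.im) ^ 2 := by
      rw [hch]
      linear_combination (-16 * (π * τ.im) ^ 2 * (1 + Real.sinh s ^ 2) * Real.sinh s ^ 2) * h3
        - 16 * (π * τ.im) ^ 2 * Real.sinh s ^ 2 * √3 ^ 2 * hch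
    linarith
  refine (summable_linear_mul_exp hα hD hc hd g k ((√3 * Real.cosh s : ℝ) : ℂ)
    ((-Real.sinh s : ℝ) : ℂ) (E := fun p ↦ 2 * π * I *
      (τ * (boostPos s (c * (p.1 + g)) (d * (p.2 + k)) : ℝ) ^ 2 -
        conj τ * (boostNeg s (c * (p.1 + g)) (d * (p.2 + k)) : ℝ) ^ 2)) fun p ↦ ?_).congr fun p ↦ ?_
  · rw [re_two_pi_I_mul_sub_conj]
    simp only [boostPos, boostNeg]
    linear_combination (-(2 * π * τ.im * (c * (p.1 + g)) ^ 2 *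
      (Real.cosh s ^ 2 + Real.sinh s ^ 2))) * h3
  · rw [siegelKernel]
    congr 1
    simp only [boostPos]
    push_cast
    ring

lemma siegelKernel_neg (τ : ℂ) (s x y : ℝ) :
    siegelKernel τ s (-x) (-y) = -siegelKernel τ s x y := by
  have h1 : boostPos s (-x) (-y) = -boostPos s x y := by simp only [boostPos]; ring
  have h2 : boostNeg s (-x) (-y) = -boostNeg s x y := by simp only [boostNeg]; ring
  rw [siegelKernel, h1, h2, siegelKernel]
  push_cast
  rw [neg_sq, neg_sq, neg_mul]

lemma siegelKernel_sub_two (τ : ℂ) (s x y : ℝ) :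
    siegelKernel (τ - 2) s x y =
      cexp (-(4 * π * I * (3 * x ^ 2 - y ^ 2))) * siegelKernel τ s x y := by
  have h : ((boostPos s x y : ℂ) ^ 2 - (boostNeg s x y : ℂ) ^ 2) = 3 * x ^ 2 - y ^ 2 := by
    exact_mod_cast congrArg ((↑) : ℝ → ℂ) (boostPos_sq_sub_boostNeg_sq s x y)
  rw [siegelKernel, siegelKernel, mul_left_comm, ← Complex.exp_add, ← h]
  congr 2
  rw [map_sub, map_ofNat]
  ring

lemma summable_siegelThetaDual {τ : ℂ} (hτ : 0 < τ.im) (s : ℝ) :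
    Summable fun p : ℤ × ℤ ↦ cexp (2 * π * I * p.1 / 3) *
      siegelKernel τ s (1 / 6 * (p.1 + -(1 / 2))) (1 / 2 * (p.2 + -(1 / 2))) := by
  refine Summable.of_norm ((summable_siegelKernel hτ s (c := 1 / 6) (d := 1 / 2) (by norm_num)
    (by norm_num) (-(1 / 2)) (-(1 / 2))).norm.congr fun p ↦ ?_)
  have : 2 * π * I * p.1 / 3 = ((2 * π * p.1 / 3 : ℝ) : ℂ) * I := by push_cast; ring
  rw [norm_mul, this, norm_exp_ofReal_mul_I, one_mul]

/-- The kernel is its own Fourier transform up to `τ ↦ -1/τ`, with the same boost, because boosts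
preserve `3x² - y²`. Passing to dual coordinates divides by the Gram entries `6` and `-2`, whence
`ξ/6` and `-η/2`. -/
lemma dual_summand_eq {t : ℂ} (ht : t ≠ 0) (s ξ η : ℝ) (e : ℂ) :
    ((√3 * Real.cosh s * -(2 * √3 * Real.cosh s * Real.sinh s * (t - conj t)) -
        -Real.sinh s * (6 * (t * Real.cosh s ^ 2 - conj t * Real.sinh s ^ 2))) * η +
      (-Real.sinh s * -(2 * √3 * Real.cosh s * Real.sinh s * (t - conj t)) -
        √3 * Real.cosh s * (2 * (t * Real.sinh s ^ 2 - conj t * Real.cosh s ^ 2))) * ξ) /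
        ((2 * √3 * ‖t‖ : ℝ) : ℂ) ^ 2 *
      cexp (π * I * ((6 * (t * Real.cosh s ^ 2 - conj t * Real.sinh s ^ 2)) * η ^ 2 -
        2 * -(2 * √3 * Real.cosh s * Real.sinh s * (t - conj t)) * η * ξ +
        2 * (t * Real.sinh s ^ 2 - conj t * Real.cosh s ^ 2) * ξ ^ 2) /
        ((2 * √3 * ‖t‖ : ℝ) : ℂ) ^ 2 + e) =
      1 / t * (cexp e * siegelKernel (-1 / t) s (1 / 6 * ξ) (-(1 / 2 * η))) := by
  have h3 : (√3 : ℂ) ^ 2 = 3 := by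
    exact_mod_cast congrArg ((↑) : ℝ → ℂ) (Real.sq_sqrt (show (0 : ℝ) ≤ 3 by norm_num))
  have hch : (Real.cosh s : ℂ) ^ 2 = 1 + (Real.sinh s : ℂ) ^ 2 := by
    exact_mod_cast congrArg ((↑) : ℝ → ℂ) (Real.cosh_sq' s)
  have ht' : conj t ≠ 0 := (map_ne_zero _).mpr ht
  have hr : ((2 * √3 * ‖t‖ : ℝ) : ℂ) ^ 2 = 12 * t * conj t := by
    have : t * conj t = (‖t‖ : ℂ) ^ 2 := mul_conj' t
    rw [mul_assoc (12 : ℂ), this]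
    push_cast
    linear_combination (4 * (‖t‖ : ℂ) ^ 2) * h3
  have hp : (boostPos s (1 / 6 * ξ) (-(1 / 2 * η)) : ℂ) =
      √3 * ξ / 6 * Real.cosh s + η / 2 * Real.sinh s := by
    simp only [boostPos]
    push_cast
    ring
  have hm : (boostNeg s (1 / 6 * ξ) (-(1 / 2 * η)) : ℂ) =
      -(η / 2 * Real.cosh s + √3 * ξ / 6 * Real.sinh s) := by
    simp only [boostNeg]
    push_cast
    ring
  rw [siegelKernel, hr, hp, hm, mul_left_comm (cexp e), ← Complex.exp_add, ← mul_assoc (1 / t),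
    map_div₀,
    map_neg, map_one]
  generalize (√3 : ℂ) = q at *
  generalize (Real.cosh s : ℂ) = C at *
  generalize (Real.sinh s : ℂ) = S at *
  generalize conj t = u at *
  congr 1
  · rw [div_eq_iff (by simp [ht, ht'])]
    field_simp
    linear_combination (-24 * C ^ 2 * S * (t - u) * η) * h3 +
      (72 * u * S * η + 24 * u * q * C * ξ) * hch
  · congr 1
    rw [add_comm]
    congr 1
    rw [div_eq_iff (by simp [ht, ht'])]
    field_simp
    linear_combination (-48 * (t * S ^ 2 - u * C ^ 2) * ξ ^ 2) * h3

lemma siegelTheta_eq_tsum_tsum {t : ℂ} (ht : 0 < t.im) (s : ℝ) :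
    siegelTheta t s = cexp (-(π * I / 3)) * (1 / ((2 * √3 * ‖t‖ : ℝ) : ℂ) *
      ∑' k : ℤ, ∑' l : ℤ, 1 / t * (cexp (2 * π * I * k / 3) *
        siegelKernel (-1 / t) s (1 / 6 * (k + -(1 / 2))) (-(1 / 2 * (l + -(1 / 2)))))) := by
  have ht0 : t ≠ 0 := fun h0 ↦ by simp [h0] at ht
  have h3 : (√3 : ℂ) ^ 2 = 3 := by
    exact_mod_cast congrArg ((↑) : ℝ → ℂ) (Real.sq_sqrt (show (0 : ℝ) ≤ 3 by norm_num))
  have h3' : √3 ^ 2 = 3 := Real.sq_sqrt (by norm_num)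
  have hch' := Real.cosh_sq' s
  have hch : (Real.cosh s : ℂ) ^ 2 = 1 + (Real.sinh s : ℂ) ^ 2 := by
    exact_mod_cast congrArg ((↑) : ℝ → ℂ) hch'
  have ha : (6 * (t * Real.cosh s ^ 2 - conj t * Real.sinh s ^ 2)).im =
      6 * t.im * (Real.cosh s ^ 2 + Real.sinh s ^ 2) := by
    simp [pow_two, -ofReal_cosh, -ofReal_sinh]
    ring
  have hb : (-(2 * √3 * Real.cosh s * Real.sinh s * (t - conj t))).im =
      -(4 * √3 * Real.cosh s * Real.sinh s * t.im) := by
    simp [-ofReal_cosh, -ofReal_sinh]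
    ring
  have hc : (2 * (t * Real.sinh s ^ 2 - conj t * Real.cosh s ^ 2)).im =
      2 * t.im * (Real.cosh s ^ 2 + Real.sinh s ^ 2) := by
    simp [pow_two, -ofReal_cosh, -ofReal_sinh]
    ring
  have hapos : 0 < 6 * t.im * (Real.cosh s ^ 2 + Real.sinh s ^ 2) := by
    have := Real.cosh_pos s
    positivity
  have hD : (-(4 * √3 * Real.cosh s * Real.sinh s * t.im)) ^ 2 <
      6 * t.im * (Real.cosh s ^ 2 + Real.sinh s ^ 2) *
        (2 * t.im * (Real.cosh s ^ 2 + Real.sinh s ^ 2)) := by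
    have h12 : 0 < 12 * t.im ^ 2 := by positivity
    have : 6 * t.im * (Real.cosh s ^ 2 + Real.sinh s ^ 2) *
        (2 * t.im * (Real.cosh s ^ 2 + Real.sinh s ^ 2)) -
        (-(4 * √3 * Real.cosh s * Real.sinh s * t.im)) ^ 2 = 12 * t.im ^ 2 := by
      rw [hch']
      linear_combination (-16 * t.im ^ 2 * (1 + Real.sinh s ^ 2) * Real.sinh s ^ 2) * h3'
        - 16 * t.im ^ 2 * Real.sinh s ^ 2 * √3 ^ 2 * hch'
    linarith
  have hr : ((2 * √3 * ‖t‖ : ℝ) : ℂ) ^ 2 = 12 * t * conj t := by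
    have : t * conj t = (‖t‖ : ℂ) ^ 2 := mul_conj' t
    rw [mul_assoc (12 : ℂ), this]
    push_cast
    linear_combination (4 * (‖t‖ : ℂ) ^ 2) * h3
  have key := tsum_gaussian_two
    (a := 6 * (t * Real.cosh s ^ 2 - conj t * Real.sinh s ^ 2))
    (b := -(2 * √3 * Real.cosh s * Real.sinh s * (t - conj t)))
    (c := 2 * (t * Real.sinh s ^ 2 - conj t * Real.cosh s ^ 2)) (ha.symm ▸ hapos) (by rw [ha, hb, hc]; exact hD)
    (r := 2 * √3 * ‖t‖) (by have := norm_pos_iff.mpr ht0; positivity) (by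
      rw [hr]
      linear_combination (-4 * (Real.cosh s : ℂ) ^ 2 * (Real.sinh s : ℂ) ^ 2 * (t - conj t) ^ 2) * h3
        - 12 * t * conj t * ((Real.cosh s : ℂ) ^ 2 - (Real.sinh s : ℂ) ^ 2 + 1) * hch)
    (1 / 3) (√3 * Real.cosh s) (-Real.sinh s)
  -- The Poisson formula twists by a character of `n + 1/3`, whereas the theta series twists by one
  -- of `n`; the constant phase `e^(-πi/3)` is the discrepancy.
  have hL : siegelTheta t s = cexp (-(π * I / 3)) * ∑' p : ℤ × ℤ,
      ((√3 : ℂ) * Real.cosh s * (p.1 + (1 / 3 : ℝ)) + -(Real.sinh s : ℂ) * p.2) *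
      cexp (π * I * (6 * (t * Real.cosh s ^ 2 - conj t * Real.sinh s ^ 2) *
        (p.1 + (1 / 3 : ℝ)) ^ 2 + 2 * -(2 * √3 * Real.cosh s * Real.sinh s * (t - conj t)) *
        (p.1 + (1 / 3 : ℝ)) * p.2 + 2 * (t * Real.sinh s ^ 2 - conj t * Real.cosh s ^ 2) *
        p.2 ^ 2) + π * I * (p.1 + (1 / 3 : ℝ)) + π * I * p.2) := by
    rw [siegelTheta, ← tsum_mul_left]
    refine tsum_congr fun p ↦ ?_
    rw [neg_one_zpow_eq_cexp, siegelKernel, mul_left_comm, mul_left_comm (cexp (-(π * I / 3))),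
      ← Complex.exp_add, ← Complex.exp_add]
    simp only [boostPos, boostNeg]
    push_cast
    congr 1
    · ring
    · congr 1
      linear_combination (2 * π * I * ((p.1 : ℂ) + 1 / 3) ^ 2 *
        (t * Complex.cosh s ^ 2 - conj t * Complex.sinh s ^ 2)) * h3
  rw [hL, key]
  congr 2
  refine tsum_congr fun k ↦ tsum_congr fun l ↦ ?_
  have := dual_summand_eq ht0 s (k + -(1 / 2)) (l + -(1 / 2)) (2 * π * I * k / 3)
  rw [← this]
  push_cast
  simp only [← sub_eq_add_neg]
  ring_nf

/-- The behaviour of the Siegel theta series under `τ ↦ -1/τ`. -/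
lemma siegelTheta_neg_one_div {τ : ℂ} (hτ : 0 < τ.im) (s : ℝ) :
    siegelTheta (-1 / τ) s =
      -(cexp (-(π * I / 3)) / (2 * √3 : ℝ)) * (τ * ‖τ‖) * siegelThetaDual τ s := by
  have hτ0 : τ ≠ 0 := fun h0 ↦ by simp [h0] at hτ
  have hn : (‖τ‖ : ℂ) ≠ 0 := by exact_mod_cast norm_ne_zero_iff.mpr hτ0
  have h3 : (√3 : ℂ) ≠ 0 := by exact_mod_cast (Real.sqrt_pos.mpr (show (0 : ℝ) < 3 by norm_num)).ne'
  have hinv : -1 / (-1 / τ) = τ := by field_simp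
  have hdual : ∑' k : ℤ, ∑' l : ℤ, cexp (2 * π * I * k / 3) *
        siegelKernel τ s (1 / 6 * (k + -(1 / 2))) (-(1 / 2 * (l + -(1 / 2)))) =
        siegelThetaDual τ s := by
    rw [siegelThetaDual, (summable_siegelThetaDual hτ s).tsum_prod]
    refine tsum_congr fun k ↦ ?_
    -- The substitution `l ↦ 1 - l` negates `l - 1/2` and absorbs the sign in the second coordinate.
    rw [← (Equiv.subLeft (1 : ℤ)).tsum_eq]
    refine tsum_congr fun l ↦ ?_
    rw [Equiv.subLeft_apply]
    push_cast
    ring_nf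
  rw [siegelTheta_eq_tsum_tsum (im_neg_one_div_pos hτ), hinv]
  simp_rw [tsum_mul_left] at hdual ⊢
  rw [hdual, norm_div, norm_neg, norm_one]
  push_cast
  field_simp

/-- The symmetrized form of the dual theta series, using oddness of the kernel. -/
lemma two_mul_siegelThetaDual {τ : ℂ} (hτ : 0 < τ.im) (s : ℝ) :
    2 * siegelThetaDual τ s = ∑' p : ℤ × ℤ,
      (cexp (2 * π * I * p.1 / 3) - cexp (2 * π * I * (1 - p.1) / 3)) *
      siegelKernel τ s (1 / 6 * (p.1 + -(1 / 2))) (1 / 2 * (p.2 + -(1 / 2))) := by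
  have h := summable_siegelThetaDual hτ s
  have h' := (Equiv.subLeft ((1, 1) : ℤ × ℤ)).summable_iff.mpr h
  have e' := (Equiv.subLeft ((1, 1) : ℤ × ℤ)).tsum_eq fun p : ℤ × ℤ ↦
    cexp (2 * π * I * p.1 / 3) *
      siegelKernel τ s (1 / 6 * (p.1 + -(1 / 2))) (1 / 2 * (p.2 + -(1 / 2)))
  rw [two_mul]
  nth_rewrite 2 [siegelThetaDual]
  rw [← e', siegelThetaDual]
  refine (h.tsum_add h').symm.trans (tsum_congr fun p ↦ ?_)
  simp only [Equiv.subLeft_apply, Prod.fst_sub, Prod.snd_sub, Function.comp_apply, sub_mul]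
  have hx : (1 / 6 * (((1 - p.1 : ℤ) : ℝ) + -(1 / 2))) = -(1 / 6 * ((p.1 : ℝ) + -(1 / 2))) := by
    push_cast; ring
  have hy : (1 / 2 * (((1 - p.2 : ℤ) : ℝ) + -(1 / 2))) = -(1 / 2 * ((p.2 : ℝ) + -(1 / 2))) := by
    push_cast; ring
  rw [hx, hy, siegelKernel_neg]
  push_cast
  ring

/-- The phase is `e^(2πi(1/12 - k(k-1)/6 + l(l-1)/2))`. It equals `zeta 12` unless `k ≡ 2 mod 3`,
and exactly for those `k` the antisymmetrized coefficient vanishes. This is why the dual series is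
symmetrized first. -/
lemma sub_mul_cexp_eq_zeta_mul (k l : ℤ) :
    (cexp (2 * π * I * k / 3) - cexp (2 * π * I * (1 - k) / 3)) *
      cexp (-(4 * π * I * (3 * ((1 / 6 * ((k : ℝ) + -(1 / 2)) : ℝ) : ℂ) ^ 2 -
        ((1 / 2 * ((l : ℝ) + -(1 / 2)) : ℝ) : ℂ) ^ 2))) =
      zeta 12 * (cexp (2 * π * I * k / 3) - cexp (2 * π * I * (1 - k) / 3)) := by
  have hk : k % 3 = 2 ∨ ∃ m : ℤ, k * (k - 1) = 6 * m := by
    have h2 : (2 : ℤ) ∣ k * (k - 1) := by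
      rw [← even_iff_two_dvd, mul_comm]
      simpa using Int.even_mul_succ_self (k - 1)
    have h3 : k % 3 = 0 ∨ k % 3 = 1 ∨ k % 3 = 2 := by omega
    rcases h3 with h | h | h
    · right
      have : (3 : ℤ) ∣ k * (k - 1) := Dvd.dvd.mul_right (by omega) _
      obtain ⟨m, hm⟩ : (6 : ℤ) ∣ k * (k - 1) := by omega
      exact ⟨m, hm⟩
    · right
      have : (3 : ℤ) ∣ k * (k - 1) := Dvd.dvd.mul_left (by omega) _
      obtain ⟨m, hm⟩ : (6 : ℤ) ∣ k * (k - 1) := by omega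
      exact ⟨m, hm⟩
    · exact Or.inl h
  rcases hk with h | ⟨m, hm⟩
  · have : cexp (2 * π * I * k / 3) = cexp (2 * π * I * (1 - k) / 3) := by
      rw [Complex.exp_eq_exp_iff_exists_int]
      refine ⟨2 * (k / 3) + 1, ?_⟩
      have hk : k = 3 * (k / 3) + 2 := by omega
      have hk' : (k : ℂ) = 3 * ((k / 3 : ℤ) : ℂ) + 2 := by exact_mod_cast hk
      rw [hk']
      push_cast
      ring
    rw [this, sub_self, zero_mul, mul_zero]
  · rw [mul_comm]
    congr 1
    obtain ⟨r, hr⟩ : ∃ r : ℤ, l * (l - 1) = 2 * r := by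
      have h2 : (2 : ℤ) ∣ l * (l - 1) := by
        rw [← even_iff_two_dvd, mul_comm]
        simpa using Int.even_mul_succ_self (l - 1)
      exact h2
    have hm' : (k : ℂ) * (k - 1) = 6 * m := by exact_mod_cast hm
    have hr' : (l : ℂ) * (l - 1) = 2 * r := by exact_mod_cast hr
    rw [zeta, Complex.exp_eq_exp_iff_exists_int]
    refine ⟨-m + r, ?_⟩
    push_cast
    linear_combination (-(π * I / 3)) * hm' + (π * I) * hr'

lemma siegelThetaDual_sub_two {τ : ℂ} (hτ : 0 < τ.im) (s : ℝ) :
    siegelThetaDual (τ - 2) s = zeta 12 * siegelThetaDual τ s := by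
  have hτ' : 0 < (τ - 2).im := by simpa using hτ
  refine mul_left_cancel₀ (two_ne_zero (α := ℂ)) ?_
  rw [two_mul_siegelThetaDual hτ', mul_left_comm, two_mul_siegelThetaDual hτ, ← tsum_mul_left]
  refine tsum_congr fun p ↦ ?_
  rw [siegelKernel_sub_two, ← mul_assoc, ← mul_assoc, sub_mul_cexp_eq_zeta_mul]

/-- With `w = -1/τ`, both sides are inversions of the dual series, at `w - 2` and at `w`. The
automorphy factors differ through `(w - 2)/w = 2τ + 1`. -/
lemma siegelTheta_mobius {τ : ℂ} (hτ : 0 < τ.im) (s : ℝ) :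
    siegelTheta (τ / (2 * τ + 1)) s =
      zeta 12 * ((2 * τ + 1) * ‖2 * τ + 1‖) * siegelTheta τ s := by
  have hτ0 : τ ≠ 0 := fun h0 ↦ by simp [h0] at hτ
  have h1 : 2 * τ + 1 ≠ 0 := fun h0 ↦ by
    have := congrArg im h0
    simp at this
    linarith
  have hw : 0 < (-1 / τ).im := im_neg_one_div_pos hτ
  have hw' : 0 < (-1 / τ - 2).im := by simpa using hw
  have e1 : τ / (2 * τ + 1) = -1 / (-1 / τ - 2) := by
    have : (-1 / τ - 2) = -((2 * τ + 1) / τ) := by field_simp; ring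
    rw [this]
    field_simp
  have e2 : siegelTheta τ s = siegelTheta (-1 / (-1 / τ)) s := by
    congr 1
    field_simp
  have e3 : -1 / τ - 2 = -((2 * τ + 1) / τ) := by field_simp; ring
  rw [e1, e2, siegelTheta_neg_one_div hw', siegelTheta_neg_one_div hw, siegelThetaDual_sub_two hw,
    e3, norm_neg, norm_div, norm_div, norm_neg, norm_one]
  have hn : (‖τ‖ : ℂ) ≠ 0 := by exact_mod_cast norm_ne_zero_iff.mpr hτ0
  push_cast
  field_simp

/-! ### The error function and the boost integral of the kernel -/

lemma incGamma_half_eq_integral_Ioi {c t : ℝ} (hc : 0 < c) (ht : 0 < t) :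
    incGamma (1 / 2) (c * t ^ 2) = 2 * √c * ∫ u in Set.Ioi t, Real.exp (-c * u ^ 2) := by
  have himage : (fun u : ℝ ↦ c * u ^ 2) '' Set.Ioi t = Set.Ioi (c * t ^ 2) := by
    ext y
    simp only [Set.mem_image, Set.mem_Ioi]
    constructor
    · rintro ⟨u, hu, rfl⟩
      gcongr
    · intro hy
      refine ⟨√(y / c), ?_, ?_⟩
      · rw [Real.lt_sqrt ht.le, lt_div_iff₀ hc]
        linarith
      · have : 0 ≤ y / c := div_nonneg ((by positivity : 0 ≤ c * t ^ 2).trans hy.le) hc.le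
        rw [Real.sq_sqrt this]
        field_simp
  have hinj : Set.InjOn (fun u : ℝ ↦ c * u ^ 2) (Set.Ioi t) := by
    intro u hu w hw h
    have hu' : 0 ≤ u := (ht.trans hu).le
    have hw' : 0 ≤ w := (ht.trans hw).le
    exact (pow_left_inj₀ hu' hw' two_ne_zero).mp (mul_left_cancel₀ hc.ne' h)
  have hd : ∀ u ∈ Set.Ioi t, HasDerivWithinAt (fun u : ℝ ↦ c * u ^ 2) (c * (2 * u)) (Set.Ioi t) u := by
    intro u _
    simpa using ((hasDerivAt_pow 2 u).const_mul c).hasDerivWithinAt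
  rw [incGamma, ← himage, integral_image_eq_integral_abs_deriv_smul measurableSet_Ioi hd hinj,
    ← integral_const_mul]
  refine setIntegral_congr_fun measurableSet_Ioi fun u hu ↦ ?_
  have hu : 0 < u := ht.trans hu
  have hsc : 0 < √c := Real.sqrt_pos.mpr hc
  have hrpow : (c * u ^ 2) ^ ((1 / 2 : ℝ) - 1) = (√c * u)⁻¹ := by
    rw [show (1 / 2 : ℝ) - 1 = -(1 / 2) by norm_num, Real.rpow_neg (by positivity),
      ← Real.sqrt_eq_rpow, Real.sqrt_mul hc.le, Real.sqrt_sq hu.le]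
  simp only [smul_eq_mul]
  rw [hrpow, abs_of_pos (by positivity), neg_mul]
  have : c = √c * √c := (Real.mul_self_sqrt hc.le).symm
  field_simp
  nlinarith

/-- The primitive of the Gaussian `u ↦ e^{-cu²}` vanishing at `0`. -/
def gaussPrimitive (c t : ℝ) : ℝ := ∫ u in (0 : ℝ)..t, Real.exp (-c * u ^ 2)

lemma hasDerivAt_gaussPrimitive (c t : ℝ) :
    HasDerivAt (gaussPrimitive c) (Real.exp (-c * t ^ 2)) t := by
  have hcont : Continuous fun u : ℝ ↦ Real.exp (-c * u ^ 2) := by fun_prop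
  exact intervalIntegral.integral_hasDerivAt_right (hcont.intervalIntegrable _ _)
    (hcont.stronglyMeasurableAtFilter _ _) hcont.continuousAt

lemma gaussPrimitive_neg (c t : ℝ) : gaussPrimitive c (-t) = -gaussPrimitive c t := by
  have := intervalIntegral.integral_comp_neg (a := 0) (b := t) fun u : ℝ ↦ Real.exp (-c * u ^ 2)
  simp only [neg_sq, neg_zero] at this
  rw [gaussPrimitive, intervalIntegral.integral_symm, ← this, gaussPrimitive]

/-- Both sides are odd in `t`, so only `t > 0` matters; there the substitution `u ↦ c u²` turns the
incomplete gamma function into a Gaussian tail. -/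
lemma sign_mul_sub_incGamma {c : ℝ} (hc : 0 < c) (t : ℝ) :
    Real.sign t * (√π - incGamma (1 / 2) (c * t ^ 2)) = 2 * √c * gaussPrimitive c t := by
  have key : ∀ t : ℝ, 0 < t → √π - incGamma (1 / 2) (c * t ^ 2) = 2 * √c * gaussPrimitive c t := by
    intro t ht
    have hint : Integrable fun u : ℝ ↦ Real.exp (-c * u ^ 2) := integrable_exp_neg_mul_sq hc
    have h1 := intervalIntegral.integral_interval_add_Ioi (a := 0) (b := t)
      hint.integrableOn hint.integrableOn
    rw [integral_gaussian_Ioi, Real.sqrt_div pi_pos.le] at h1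
    have hsc : 0 < √c := Real.sqrt_pos.mpr hc
    rw [incGamma_half_eq_integral_Ioi hc ht, gaussPrimitive]
    set A := ∫ u in (0 : ℝ)..t, Real.exp (-c * u ^ 2)
    set B := ∫ u in Set.Ioi t, Real.exp (-c * u ^ 2)
    field_simp at h1
    linarith
  rcases lt_trichotomy t 0 with h | h | h
  · have := key (-t) (by linarith)
    rw [neg_sq, gaussPrimitive_neg] at this
    rw [Real.sign_of_neg h, this]
    ring
  · simp [h, gaussPrimitive]
  · rw [Real.sign_of_pos h, one_mul, key t h]

lemma norm_incGamma_half_le {y : ℝ} (hy : 0 < y) :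
    ‖incGamma (1 / 2) y‖ ≤ y ^ (-(1 / 2) : ℝ) * Real.exp (-y) := by
  rw [← integral_exp_neg_Ioi, ← integral_const_mul]
  refine norm_integral_le_of_norm_le ((integrableOn_exp_neg_Ioi y).const_mul _) ?_
  refine (ae_restrict_mem measurableSet_Ioi).mono fun t ht ↦ ?_
  have ht0 : 0 < t := hy.trans ht
  rw [Real.norm_of_nonneg (by positivity), mul_comm]
  gcongr
  rw [show (1 / 2 : ℝ) - 1 = -(1 / 2) by norm_num]
  exact Real.rpow_le_rpow_of_nonpos hy (le_of_lt ht) (by norm_num)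

/-- The boost taking the `y`-axis to the line spanned by `(1, 3)`. -/
def boostEnd : ℝ := Real.arsinh (√2)⁻¹

lemma sinh_boostEnd : Real.sinh boostEnd = (√2)⁻¹ := Real.sinh_arsinh _

lemma cosh_boostEnd : Real.cosh boostEnd = √(3 / 2) := by
  rw [boostEnd, Real.cosh_arsinh, inv_pow, Real.sq_sqrt (by norm_num)]
  norm_num

lemma boostEnd_nonneg : 0 ≤ boostEnd := Real.arsinh_nonneg_iff.mpr (by positivity)

lemma boostNeg_boostEnd (x y : ℝ) : boostNeg boostEnd x y = -(√(3 / 2) * (x - y)) := by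
  rw [boostNeg, cosh_boostEnd, sinh_boostEnd, Real.sqrt_div (by norm_num)]
  ring

lemma boostNeg_neg_boostEnd (x y : ℝ) : boostNeg (-boostEnd) x y = √(3 / 2) * (x + y) := by
  rw [boostNeg, Real.cosh_neg, Real.sinh_neg, cosh_boostEnd, sinh_boostEnd,
    Real.sqrt_div (by norm_num)]
  ring

lemma hasDerivAt_boostNeg (s x y : ℝ) :
    HasDerivAt (fun s ↦ boostNeg s x y) (-boostPos s x y) s := by
  have := ((Real.hasDerivAt_cosh s).const_mul y).sub ((Real.hasDerivAt_sinh s).const_mul (√3 * x))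
  refine this.congr_deriv ?_
  rw [boostPos]
  ring

lemma continuous_boostPos (x y : ℝ) : Continuous fun s ↦ boostPos s x y := by
  unfold boostPos
  fun_prop

lemma continuous_boostNeg (x y : ℝ) : Continuous fun s ↦ boostNeg s x y := by
  unfold boostNeg
  fun_prop

lemma continuous_siegelKernel (τ : ℂ) (x y : ℝ) : Continuous fun s ↦ siegelKernel τ s x y := by
  have h1 := continuous_boostPos x y
  have h2 := continuous_boostNeg x y
  unfold siegelKernel
  fun_prop

/-- The integrand is the `s`-derivative of `-gaussPrimitive c (boostNeg s x y)`. -/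
lemma integral_boostPos_mul_exp (c x y : ℝ) :
    ∫ s in (-boostEnd)..boostEnd, boostPos s x y * Real.exp (-c * boostNeg s x y ^ 2) =
      gaussPrimitive c (√(3 / 2) * (x + y)) + gaussPrimitive c (√(3 / 2) * (x - y)) := by
  have hd : ∀ s ∈ Set.uIcc (-boostEnd) boostEnd, HasDerivAt
      (fun s ↦ -gaussPrimitive c (boostNeg s x y))
      (boostPos s x y * Real.exp (-c * boostNeg s x y ^ 2)) s := by
    intro s _
    have := ((hasDerivAt_gaussPrimitive c (boostNeg s x y)).comp s (hasDerivAt_boostNeg s x y)).neg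
    refine this.congr_deriv ?_
    ring
  have h1 := continuous_boostPos x y
  have h2 := continuous_boostNeg x y
  rw [intervalIntegral.integral_eq_sub_of_hasDerivAt hd
    (Continuous.intervalIntegrable (by fun_prop) _ _), boostNeg_boostEnd, boostNeg_neg_boostEnd,
    gaussPrimitive_neg]
  ring

lemma siegelKernel_eq (τ : ℂ) (s x y : ℝ) :
    siegelKernel τ s x y = qPow τ (3 * x ^ 2 - y ^ 2) *
      ((boostPos s x y * Real.exp (-(4 * π * τ.im) * boostNeg s x y ^ 2) : ℝ) : ℂ) := by
  have hconj : conj τ = τ - 2 * τ.im * I := by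
    apply Complex.ext <;> simp
    ring
  rw [← boostPos_sq_sub_boostNeg_sq s, siegelKernel, qPow, hconj, ofReal_mul, ofReal_exp,
    mul_left_comm, ← Complex.exp_add]
  congr 2
  push_cast
  linear_combination (4 * π * τ.im * (boostNeg s x y : ℂ) ^ 2) * I_sq

/-- The completed sign function at `z`, up to the factor `√π`. -/
def completedSign (v z : ℝ) : ℝ :=
  Real.sign z * (√π - incGamma (1 / 2) (6 * π * z ^ 2 * v))

/-- The endpoint factor `√(3/2)` turns `4πv` into the constant `6πv` of the incomplete gamma
argument. The factor `2√v` cancels the width of the Gaussian. -/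
lemma two_sqrt_mul_integral_siegelKernel {τ : ℂ} (hτ : 0 < τ.im) (x y : ℝ) :
    (2 * √τ.im : ℝ) * ∫ s in (-boostEnd)..boostEnd, siegelKernel τ s x y =
      ((1 / (2 * √π) * (completedSign τ.im (x + y) + completedSign τ.im (x - y)) : ℝ) : ℂ) *
        qPow τ (3 * x ^ 2 - y ^ 2) := by
  have hc : 0 < 4 * π * τ.im := by positivity
  have hE : ∀ z : ℝ, completedSign τ.im z =
      2 * √(4 * π * τ.im) * gaussPrimitive (4 * π * τ.im) (√(3 / 2) * z) := by
    intro z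
    have h := sign_mul_sub_incGamma hc (√(3 / 2) * z)
    have hs : Real.sign (√(3 / 2) * z) = Real.sign z := by
      have h0 : (0 : ℝ) < √(3 / 2) := by positivity
      rcases lt_trichotomy z 0 with hz | hz | hz
      · rw [Real.sign_of_neg hz, Real.sign_of_neg (mul_neg_of_pos_of_neg h0 hz)]
      · simp [hz]
      · rw [Real.sign_of_pos hz, Real.sign_of_pos (mul_pos h0 hz)]
    rw [hs, mul_pow, Real.sq_sqrt (by norm_num)] at h
    rw [← h, completedSign]
    congr 3
    ring
  have hsq : √(4 * π * τ.im) = 2 * √π * √τ.im := by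
    rw [Real.sqrt_mul (by positivity), Real.sqrt_mul (by norm_num),
      show (4 : ℝ) = 2 ^ 2 by norm_num, Real.sqrt_sq (by norm_num)]
  simp_rw [siegelKernel_eq]
  rw [intervalIntegral.integral_const_mul, intervalIntegral.integral_ofReal,
    integral_boostPos_mul_exp, hE, hE, hsq, mul_left_comm, mul_comm (qPow _ _), ← ofReal_mul]
  congr 2
  have : √π ≠ 0 := (Real.sqrt_pos.mpr pi_pos).ne'
  field_simp

/-- Inverting the boost bounds `3x²` and `y²` by `cosh² + sinh² ≤ 2` times the boosted norm. The
constant `6` is not sharp; uniformity in `s` is what dominated convergence needs. -/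
lemma sq_add_sq_le_boost {s : ℝ} (hs : |s| ≤ boostEnd) (x y : ℝ) :
    x ^ 2 + y ^ 2 ≤ 6 * (boostPos s x y ^ 2 + boostNeg s x y ^ 2) := by
  have hc : Real.cosh s ^ 2 ≤ 3 / 2 := by
    have h1 : Real.cosh s ≤ √(3 / 2) := by
      rw [← cosh_boostEnd, Real.cosh_le_cosh, abs_of_nonneg boostEnd_nonneg]
      exact hs
    calc Real.cosh s ^ 2 ≤ √(3 / 2) ^ 2 := by gcongr
      _ = 3 / 2 := Real.sq_sqrt (by norm_num)
  have hch := Real.cosh_sq' s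
  have h3 : √3 ^ 2 = 3 := Real.sq_sqrt (by norm_num)
  have hx : √3 * x = boostPos s x y * Real.cosh s + boostNeg s x y * Real.sinh s := by
    simp only [boostPos, boostNeg]
    linear_combination (-√3 * x) * hch
  have hy : y = boostPos s x y * Real.sinh s + boostNeg s x y * Real.cosh s := by
    simp only [boostPos, boostNeg]
    linear_combination (-y) * hch
  have hx2 : 3 * x ^ 2 = (boostPos s x y * Real.cosh s + boostNeg s x y * Real.sinh s) ^ 2 := by
    rw [← hx, mul_pow, h3]
  have hy2 : y ^ 2 = (boostPos s x y * Real.sinh s + boostNeg s x y * Real.cosh s) ^ 2 := by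
    rw [← hy]
  generalize boostPos s x y = p at *
  generalize boostNeg s x y = m at *
  have e1 : (p * Real.cosh s + m * Real.sinh s) ^ 2 ≤
      (p ^ 2 + m ^ 2) * (Real.cosh s ^ 2 + Real.sinh s ^ 2) := by
    nlinarith [sq_nonneg (p * Real.sinh s - m * Real.cosh s)]
  have e2 : (p * Real.sinh s + m * Real.cosh s) ^ 2 ≤
      (p ^ 2 + m ^ 2) * (Real.cosh s ^ 2 + Real.sinh s ^ 2) := by
    nlinarith [sq_nonneg (p * Real.cosh s - m * Real.sinh s)]
  have e3 : (p ^ 2 + m ^ 2) * (Real.cosh s ^ 2 + Real.sinh s ^ 2) ≤ (p ^ 2 + m ^ 2) * 2 := by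
    gcongr
    linarith
  nlinarith [sq_nonneg x]

lemma abs_boostPos_le {s : ℝ} (hs : |s| ≤ boostEnd) (x y : ℝ) :
    |boostPos s x y| ≤ 4 * ((1 + |x|) * (1 + |y|)) := by
  have hc : Real.cosh s ≤ 2 := by
    have h1 : Real.cosh s ≤ √(3 / 2) := by
      rw [← cosh_boostEnd, Real.cosh_le_cosh, abs_of_nonneg boostEnd_nonneg]
      exact hs
    refine h1.trans ?_
    rw [Real.sqrt_le_left (by norm_num)]
    norm_num
  have hs' : |Real.sinh s| ≤ 2 := by
    refine (abs_le_of_sq_le_sq ?_ (Real.cosh_pos s).le).trans hc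
    rw [Real.cosh_sq' s]
    linarith
  have h3 : √3 ≤ 2 := by
    rw [Real.sqrt_le_left (by norm_num)]
    norm_num
  have hx := abs_nonneg x
  have hy := abs_nonneg y
  calc |boostPos s x y| ≤ |√3 * x * Real.cosh s| + |y * Real.sinh s| := abs_sub _ _
    _ = √3 * |x| * Real.cosh s + |y| * |Real.sinh s| := by
      rw [abs_mul, abs_mul, abs_mul, abs_of_nonneg (Real.sqrt_nonneg 3),
        abs_of_pos (Real.cosh_pos s)]
    _ ≤ 2 * |x| * 2 + |y| * 2 := by
      have := (Real.cosh_pos s).le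
      gcongr
    _ ≤ 4 * ((1 + |x|) * (1 + |y|)) := by nlinarith [mul_nonneg hx hy]

/-- Termwise integration of the Siegel theta series over the boost parameter. -/
lemma hasSum_integral_siegelKernel {τ : ℂ} (hτ : 0 < τ.im) :
    HasSum (fun p : ℤ × ℤ ↦ ∫ s in (-boostEnd)..boostEnd,
      (-1) ^ (p.1 + p.2) * siegelKernel τ s (p.1 + 1 / 3) p.2)
      (∫ s in (-boostEnd)..boostEnd, siegelTheta τ s) := by
  have hδ : 0 < π * τ.im / 3 := by positivity
  have hsum := ((summable_exp_neg_sq_add_sq hδ one_pos one_pos (1 / 3) 0).mul_left 4)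
  simp only [one_mul, add_zero] at hsum
  have hb : ∀ (p : ℤ × ℤ) (s : ℝ), s ∈ Set.uIoc (-boostEnd) boostEnd →
      ‖(-1 : ℂ) ^ (p.1 + p.2) * siegelKernel τ s (p.1 + 1 / 3) p.2‖ ≤
      4 * ((1 + |(p.1 : ℝ) + 1 / 3|) * (1 + |(p.2 : ℝ)|) *
        Real.exp (-(π * τ.im / 3) * (((p.1 : ℝ) + 1 / 3) ^ 2 + (p.2 : ℝ) ^ 2))) := by
    intro p s hs
    have hs : |s| ≤ boostEnd := by
      rw [Set.uIoc_of_le (by linarith [boostEnd_nonneg])] at hs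
      exact abs_le.mpr ⟨hs.1.le, hs.2⟩
    rw [norm_mul, norm_zpow, norm_neg, norm_one, one_zpow, one_mul, norm_siegelKernel, ← mul_assoc]
    refine mul_le_mul (abs_boostPos_le hs _ _) ?_ (Real.exp_pos _).le (by positivity)
    rw [Real.exp_le_exp, neg_mul, neg_le_neg_iff]
    have := sq_add_sq_le_boost hs (p.1 + 1 / 3) p.2
    have hv : 0 < π * τ.im := by positivity
    nlinarith [mul_le_mul_of_nonneg_left this hv.le]
  refine intervalIntegral.hasSum_integral_of_dominated_convergence (fun p _ ↦
    4 * ((1 + |(p.1 : ℝ) + 1 / 3|) * (1 + |(p.2 : ℝ)|) *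
        Real.exp (-(π * τ.im / 3) * (((p.1 : ℝ) + 1 / 3) ^ 2 + (p.2 : ℝ) ^ 2)))) ?_ ?_ ?_ ?_ ?_
  · intro p
    exact ((continuous_siegelKernel τ _ _).const_mul _).aestronglyMeasurable
  · exact fun p ↦ Filter.Eventually.of_forall fun s hs ↦ hb p s hs
  · exact Filter.Eventually.of_forall fun s _ ↦ hsum
  · exact intervalIntegrable_const
  · exact Filter.Eventually.of_forall fun s hs ↦
      (Summable.of_norm_bounded hsum fun p ↦ hb p s hs).hasSum

/-! ### The non-holomorphic part as a lattice sum -/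

lemma qPow_add (τ : ℂ) (x y : ℝ) : qPow τ (x + y) = qPow τ x * qPow τ y := by
  rw [qPow, qPow, qPow, ← Complex.exp_add]
  push_cast
  ring_nf

lemma qPow_intCast (τ : ℂ) (n : ℤ) : qPow τ n = qPow τ 1 ^ n := by
  rw [qPow, qPow, ← Complex.exp_int_mul]
  push_cast
  ring_nf

lemma norm_qPow (τ : ℂ) (x : ℝ) : ‖qPow τ x‖ = Real.exp (-(2 * π * τ.im * x)) := by
  rw [qPow, Complex.norm_exp]
  congr 1
  simp

lemma hasSum_of_eq {ι : Type*} {f g : ι → ℂ} {a : ℂ} (hf : HasSum f a) (h : ∀ i, g i = f i) :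
    HasSum g a :=
  (funext h : g = f) ▸ hf

lemma summable_minusTerm {τ : ℂ} (hτ : 0 < τ.im) (ε : ℕ) : Summable (minusTerm τ ε) := by
  have hδ : 0 < π * τ.im := by positivity
  have hK : 0 < 6 * π * (1 / 9) * τ.im := by positivity
  refine summable_of_norm_le_gaussian hδ (C := (6 * π * (1 / 9) * τ.im) ^ (-(1 / 2) : ℝ))
    (c := 2) (d := 2) (g := (ε + 1) / 2) (h := (ε + 1 / 3) / 2) two_pos two_pos fun p ↦ ?_
  -- A number in `ℤ + 1/3` has absolute value at least `1/3`, which keeps the factor `y^(-1/2)` in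
  -- the gamma bound bounded.
  have hz : 1 / 9 ≤ (2 * (p.2 : ℝ) + ε + 1 / 3) ^ 2 := by
    obtain ⟨m, hm⟩ : ∃ m : ℤ, m = 2 * p.2 + ε := ⟨_, rfl⟩
    have hm' : (2 * (p.2 : ℝ) + ε) = m := by rw [hm]; push_cast; rfl
    rw [hm']
    have h0 : 0 ≤ m * (3 * m + 2) := by
      rcases le_or_gt 0 m with h | h
      · positivity
      · exact mul_nonneg_of_nonpos_of_nonpos h.le (by omega)
    have h0' : (0 : ℝ) ≤ m * (3 * m + 2) := by exact_mod_cast h0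
    nlinarith
  have hsign : |Real.sign (2 * (p.2 : ℝ) + ε + 1 / 3)| ≤ 1 := by
    rcases Real.sign_apply_eq (2 * (p.2 : ℝ) + ε + 1 / 3) with h | h | h <;> rw [h] <;> norm_num
  have hw : 2 * ((p.2 : ℝ) + (ε + 1 / 3) / 2) = 2 * p.2 + ε + 1 / 3 := by ring
  have hu : 2 * ((p.1 : ℝ) + (ε + 1) / 2) = 2 * p.1 + ε + 1 := by ring
  rw [minusTerm, norm_mul, norm_qPow, Complex.norm_real, norm_mul, hw, hu]
  set z : ℝ := 2 * (p.2 : ℝ) + ε + 1 / 3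
  set u : ℝ := 2 * (p.1 : ℝ) + ε + 1
  have hy : 6 * π * (1 / 9) * τ.im ≤ 6 * π * z ^ 2 * τ.im := by gcongr
  have hG := norm_incGamma_half_le (hK.trans_le hy)
  have hG' : ‖incGamma (1 / 2) (6 * π * z ^ 2 * τ.im)‖ ≤
      (6 * π * (1 / 9) * τ.im) ^ (-(1 / 2) : ℝ) * Real.exp (-(6 * π * z ^ 2 * τ.im)) := by
    refine hG.trans ?_
    gcongr ?_ * _
    exact Real.rpow_le_rpow_of_nonpos hK hy (by norm_num)
  calc ‖Real.sign z‖ * ‖incGamma (1 / 2) (6 * π * z ^ 2 * τ.im)‖ *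
        Real.exp (-(2 * π * τ.im * (-(3 / 2) * z ^ 2 + 1 / 2 * u ^ 2)))
      ≤ 1 * ((6 * π * (1 / 9) * τ.im) ^ (-(1 / 2) : ℝ) * Real.exp (-(6 * π * z ^ 2 * τ.im))) *
        Real.exp (-(2 * π * τ.im * (-(3 / 2) * z ^ 2 + 1 / 2 * u ^ 2))) := by
        gcongr
        exact hsign
    -- The decay `e^(-6πvz²)` of the gamma factor outweighs the growth `e^(3πvz²)` of the `q`-power.
    _ = (6 * π * (1 / 9) * τ.im) ^ (-(1 / 2) : ℝ) * 1 *
        Real.exp (-(3 * π * τ.im * z ^ 2 + π * τ.im * u ^ 2)) := by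
        rw [one_mul, mul_assoc, ← Real.exp_add, mul_one]
        ring_nf
    _ ≤ _ := by
        gcongr
        · nlinarith [abs_nonneg u, abs_nonneg z, mul_nonneg (abs_nonneg u) (abs_nonneg z)]
        · nlinarith [mul_nonneg hδ.le (sq_nonneg z)]

/-- `(n, r)` in the class `ε` corresponds to the lattice point with `x - y = 2r + ε` and
`3x - y = 2n + ε`. -/
def parityEquiv : (ℤ × ℤ) ⊕ (ℤ × ℤ) ≃ ℤ × ℤ where
  toFun := Sum.elim (fun p ↦ (p.1 - p.2, p.1 - 3 * p.2)) fun p ↦ (p.1 - p.2, p.1 - 3 * p.2 - 1)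
  invFun p := if (p.1 - p.2) % 2 = 0 then Sum.inl (p.1 + (p.1 - p.2) / 2, (p.1 - p.2) / 2)
    else Sum.inr (p.1 + (p.1 - p.2) / 2, (p.1 - p.2) / 2)
  left_inv := by
    rintro (⟨n, r⟩ | ⟨n, r⟩)
    · have : (n - r - (n - 3 * r)) % 2 = 0 := by omega
      simp only [Sum.elim_inl, this, if_true, Sum.inl.injEq, Prod.mk.injEq]
      omega
    · have : ¬(n - r - (n - 3 * r - 1)) % 2 = 0 := by omega
      simp only [Sum.elim_inr, this, if_false, Sum.inr.injEq, Prod.mk.injEq]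
      omega
  right_inv := by
    rintro ⟨x, y⟩
    by_cases h : (x - y) % 2 = 0
    · simp only [h, if_true, Sum.elim_inl, Prod.mk.injEq]
      omega
    · simp only [h, if_false, Sum.elim_inr, Prod.mk.injEq]
      omega

/-- The summand of the non-holomorphic part in lattice coordinates. -/
def minusLatticeTerm (τ : ℂ) (p : ℤ × ℤ) : ℂ :=
  (-1) ^ (p.1 + p.2) * (((Real.sign (p.1 + 1 / 3 - p.2) *
    incGamma (1 / 2) (6 * π * (p.1 + 1 / 3 - p.2) ^ 2 * τ.im) : ℝ) : ℂ) *
      qPow τ (3 * (p.1 + 1 / 3) ^ 2 - p.2 ^ 2))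

/-- The exponents match through `3x² - y² = -(3/2)(x - y)² + (1/2)(3x - y)²`, and the twist is
`(-1)^ε` because `ε` is the parity of the integral `x - y`. -/
lemma hasSum_minusLatticeTerm {τ : ℂ} (hτ : 0 < τ.im) :
    HasSum (minusLatticeTerm τ) (-√π * Hminus τ) := by
  have h0 := (summable_minusTerm hτ 0).hasSum
  have h1 := (summable_minusTerm hτ 1).hasSum.neg
  have hval : -√π * Hminus τ = ∑' p, minusTerm τ 0 p + -∑' p, minusTerm τ 1 p := by
    have : (√π : ℂ) ≠ 0 := by exact_mod_cast (Real.sqrt_pos.mpr pi_pos).ne'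
    rw [Hminus, Finset.sum_range_succ, Finset.sum_range_one]
    push_cast
    field_simp
  rw [hval, ← parityEquiv.hasSum_iff]
  refine HasSum.sum ?_ ?_
  · refine hasSum_of_eq h0 fun ⟨n, r⟩ ↦ ?_
    simp only [Function.comp_apply, parityEquiv, Equiv.coe_fn_mk, Sum.elim_inl, minusLatticeTerm,
      minusTerm]
    have he : Even (n - r + (n - 3 * r)) := ⟨n - 2 * r, by ring⟩
    rw [he.neg_one_zpow, one_mul]
    push_cast
    ring_nf
  · refine hasSum_of_eq h1 fun ⟨n, r⟩ ↦ ?_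
    simp only [Function.comp_apply, parityEquiv, Equiv.coe_fn_mk, Sum.elim_inr, minusLatticeTerm,
      minusTerm]
    have he : Odd (n - r + (n - 3 * r - 1)) := ⟨n - 2 * r - 1, by ring⟩
    rw [he.neg_one_zpow, neg_one_mul]
    push_cast
    ring_nf

/-! ### The holomorphic part as a lattice sum -/

/-- The summand of the holomorphic part in lattice coordinates. -/
def coneTerm (τ : ℂ) (p : ℤ × ℤ) : ℂ :=
  (-1) ^ (p.1 + p.2) * (((1 / 2 * (Real.sign (p.1 + 1 / 3 + p.2) +
    Real.sign (p.1 + 1 / 3 - p.2)) : ℝ) : ℂ) * qPow τ (3 * (p.1 + 1 / 3) ^ 2 - p.2 ^ 2))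

lemma hasSum_coneTerm {τ : ℂ} (hτ : 0 < τ.im) :
    HasSum (coneTerm τ)
      ((2 * √τ.im : ℝ) * (∫ s in (-boostEnd)..boostEnd, siegelTheta τ s) - Hminus τ) := by
  have hpi : (√π : ℂ) ≠ 0 := by exact_mod_cast (Real.sqrt_pos.mpr pi_pos).ne'
  have h1 := (hasSum_integral_siegelKernel hτ).mul_left (((2 * √τ.im : ℝ) : ℂ))
  have h2 := hasSum_minusLatticeTerm hτ
  -- The corrections at `x + y` and `x - y` are exchanged by `y ↦ -y`, so each contributes half of
  -- `Hminus`.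
  have h3 := ((Equiv.prodCongr (Equiv.refl ℤ) (Equiv.neg ℤ)).hasSum_iff
    (f := minusLatticeTerm τ)).mpr h2
  have hval : (2 * √τ.im : ℝ) * (∫ s in (-boostEnd)..boostEnd, siegelTheta τ s) - Hminus τ =
      (2 * √τ.im : ℝ) * (∫ s in (-boostEnd)..boostEnd, siegelTheta τ s) +
        1 / (2 * √π) * (-√π * Hminus τ + -√π * Hminus τ) := by
    field_simp
    ring
  rw [hval]
  refine hasSum_of_eq (h1.add ((h2.add h3).mul_left (1 / (2 * √π : ℂ)))) fun p ↦ ?_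
  rw [intervalIntegral.integral_const_mul, mul_left_comm, two_sqrt_mul_integral_siegelKernel hτ]
  simp only [Function.comp_apply, Equiv.prodCongr_apply, Prod.map, Equiv.refl_apply,
    Equiv.neg_apply, minusLatticeTerm, coneTerm, completedSign, Int.cast_neg, sub_neg_eq_add, neg_sq]
  have hs : (-1 : ℂ) ^ (p.1 + -p.2) = (-1) ^ (p.1 + p.2) := by
    rw [zpow_add₀ (by norm_num), zpow_add₀ (by norm_num), zpow_neg, ← inv_zpow]
    norm_num
  rw [hs]
  push_cast
  field_simp
  ring

lemma sign_add_add_sign_sub_of_abs_lt {x y : ℝ} (h : |y| < x) :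
    Real.sign (x + y) + Real.sign (x - y) = 2 := by
  rw [abs_lt] at h
  rw [Real.sign_of_pos (by linarith), Real.sign_of_pos (by linarith)]
  norm_num

lemma sign_add_add_sign_sub_of_lt_neg_abs {x y : ℝ} (h : x < -|y|) :
    Real.sign (x + y) + Real.sign (x - y) = -2 := by
  have h1 := le_abs_self y
  have h2 := neg_abs_le y
  rw [Real.sign_of_neg (by linarith), Real.sign_of_neg (by linarith)]
  norm_num

lemma sign_add_add_sign_sub_of_lt_abs {x y : ℝ} (h : |x| < |y|) :
    Real.sign (x + y) + Real.sign (x - y) = 0 := by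
  rw [abs_lt] at h
  rcases le_total 0 y with hy | hy
  · rw [abs_of_nonneg hy] at h
    rw [Real.sign_of_pos (by linarith), Real.sign_of_neg (by linarith)]
    norm_num
  · rw [abs_of_nonpos hy] at h
    rw [Real.sign_of_neg (by linarith), Real.sign_of_pos (by linarith)]
    norm_num

/-- Since `j` is an integer, `|j| < n + 1/3` means `|j| ≤ n`; no lattice point lies on the boundary
of the cone. -/
lemma tsum_coneTerm_natCast (τ : ℂ) (n : ℕ) :
    ∑' j : ℤ, coneTerm τ ((n : ℤ), j) = qPow τ (1 / 3) * ((-1) ^ n *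
      qPow τ 1 ^ (3 * n ^ 2 + 2 * n) *
      ∑ j ∈ Finset.Icc (-(n : ℤ)) (n : ℤ), (-1 : ℂ) ^ j * qPow τ 1 ^ (-(j ^ 2))) := by
  rw [tsum_eq_sum (s := Finset.Icc (-(n : ℤ)) (n : ℤ)), Finset.mul_sum, Finset.mul_sum]
  · refine Finset.sum_congr rfl fun j hj ↦ ?_
    rw [Finset.mem_Icc, ← abs_le] at hj
    have hj' : |(j : ℝ)| ≤ n := by exact_mod_cast hj
    have hs := sign_add_add_sign_sub_of_abs_lt (x := (n : ℝ) + 1 / 3) (y := j) (by linarith)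
    have hq : (3 * ((n : ℝ) + 1 / 3) ^ 2 - (j : ℝ) ^ 2) =
        1 / 3 + (((3 * n ^ 2 + 2 * n : ℕ) : ℤ) : ℝ) + ((-(j ^ 2) : ℤ) : ℝ) := by
      push_cast
      ring
    simp only [coneTerm, Int.cast_natCast]
    rw [hs, hq, qPow_add, qPow_add, qPow_intCast, qPow_intCast, zpow_natCast,
      zpow_add₀ (by norm_num), zpow_natCast]
    push_cast
    ring
  · intro j hj
    rw [Finset.mem_Icc, ← abs_le, not_le] at hj
    have hj' : (n : ℝ) + 1 ≤ |(j : ℝ)| := by exact_mod_cast hj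
    have hs := sign_add_add_sign_sub_of_lt_abs (x := (n : ℝ) + 1 / 3) (y := j) (by
      rw [abs_of_nonneg (by positivity)]
      linarith)
    simp only [coneTerm, Int.cast_natCast]
    rw [hs]
    simp

/-- On the opposite half of the cone the value `-1` cancels the extra sign in `(-1)^(n+1)`, and `3(n
+ 2/3)² = 1/3 + (3n² + 2n) + (2n + 1)` yields the summand with `q^(2n+1)`. -/
lemma tsum_coneTerm_neg (τ : ℂ) (n : ℕ) :
    ∑' j : ℤ, coneTerm τ (-((n : ℤ) + 1), j) = qPow τ (1 / 3) * ((-1) ^ n *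
      qPow τ 1 ^ (3 * n ^ 2 + 2 * n) * qPow τ 1 ^ (2 * n + 1) *
      ∑ j ∈ Finset.Icc (-(n : ℤ)) (n : ℤ), (-1 : ℂ) ^ j * qPow τ 1 ^ (-(j ^ 2))) := by
  rw [tsum_eq_sum (s := Finset.Icc (-(n : ℤ)) (n : ℤ)), Finset.mul_sum, Finset.mul_sum]
  · refine Finset.sum_congr rfl fun j hj ↦ ?_
    rw [Finset.mem_Icc, ← abs_le] at hj
    have hj' : |(j : ℝ)| ≤ n := by exact_mod_cast hj
    have hs := sign_add_add_sign_sub_of_lt_neg_abs (x := -((n : ℝ) + 1) + 1 / 3) (y := j)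
      (by linarith)
    have hq : (3 * (-((n : ℝ) + 1) + 1 / 3) ^ 2 - (j : ℝ) ^ 2) =
        1 / 3 + (((3 * n ^ 2 + 2 * n : ℕ) : ℤ) : ℝ) + (((2 * n + 1 : ℕ) : ℤ) : ℝ) +
          ((-(j ^ 2) : ℤ) : ℝ) := by
      push_cast
      ring
    have hsign : (-1 : ℂ) ^ (-((n : ℤ) + 1)) = -(-1) ^ n := by
      rw [zpow_neg, ← inv_zpow, inv_neg, inv_one, zpow_add₀ (by norm_num), zpow_natCast, zpow_one]
      ring
    simp only [coneTerm, Int.cast_neg, Int.cast_add, Int.cast_one, Int.cast_natCast]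
    rw [hs, hq, qPow_add, qPow_add, qPow_add, qPow_intCast, qPow_intCast, qPow_intCast,
      zpow_natCast, zpow_natCast, zpow_add₀ (by norm_num), hsign]
    push_cast
    ring
  · intro j hj
    rw [Finset.mem_Icc, ← abs_le, not_le] at hj
    have hj' : (n : ℝ) + 1 ≤ |(j : ℝ)| := by exact_mod_cast hj
    have hs := sign_add_add_sign_sub_of_lt_abs (x := -((n : ℝ) + 1) + 1 / 3) (y := j) (by
      rw [abs_of_nonpos (by have : (0 : ℝ) ≤ n := n.cast_nonneg; linarith)]
      linarith)
    simp only [coneTerm, Int.cast_neg, Int.cast_add, Int.cast_one, Int.cast_natCast]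
    rw [hs]
    simp

/-- Summing over columns and pairing column `n` with column `-(n+1)` produces the factor `1 +
q^(2n+1)`. Convergence of the Hecke series is inherited from the lattice sum. -/
lemma hasSum_heckeTerm {τ : ℂ} (hτ : 0 < τ.im) :
    HasSum (fun n ↦ qPow τ (1 / 3) * heckeTerm (qPow τ 1) n)
      ((2 * √τ.im : ℝ) * (∫ s in (-boostEnd)..boostEnd, siegelTheta τ s) - Hminus τ) := by
  have h := hasSum_coneTerm hτ
  have h' := (h.prod_fiberwise fun n ↦ (h.summable.prod_factor n).hasSum).nat_add_neg_add_one
  refine hasSum_of_eq h' fun n ↦ ?_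
  rw [tsum_coneTerm_natCast, tsum_coneTerm_neg, heckeTerm]
  ring

lemma summable_heckeTerm {τ : ℂ} (hτ : 0 < τ.im) : Summable (heckeTerm (qPow τ 1)) :=
  (summable_mul_left_iff (Complex.exp_ne_zero _)).mp (hasSum_heckeTerm hτ).summable

/-- The completion as the boost integral of the Siegel theta series. -/
lemma Hhat_eq_integral {τ : ℂ} (hτ : 0 < τ.im) :
    Hhat τ = (2 * √τ.im : ℝ) * ∫ s in (-boostEnd)..boostEnd, siegelTheta τ s := by
  have h := (hasSum_heckeTerm hτ).tsum_eq
  rw [tsum_mul_left] at h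
  rw [Hhat, heckeH, h, sub_add_cancel]

/-! ### Transformation laws -/

lemma siegelKernel_add_one (τ : ℂ) (s x y : ℝ) :
    siegelKernel (τ + 1) s x y = qPow 1 (3 * x ^ 2 - y ^ 2) * siegelKernel τ s x y := by
  rw [← boostPos_sq_sub_boostNeg_sq s, siegelKernel, siegelKernel, qPow, mul_left_comm,
    ← Complex.exp_add]
  congr 2
  rw [map_add, map_one]
  push_cast
  ring

lemma siegelTheta_add_one (τ : ℂ) (s : ℝ) :
    siegelTheta (τ + 1) s = zeta 3 * siegelTheta τ s := by
  rw [siegelTheta, siegelTheta, ← tsum_mul_left]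
  refine tsum_congr fun p ↦ ?_
  have hq : qPow 1 (3 * ((p.1 : ℝ) + 1 / 3) ^ 2 - (p.2 : ℝ) ^ 2) = zeta 3 := by
    rw [qPow, zeta, Complex.exp_eq_exp_iff_exists_int]
    refine ⟨3 * p.1 ^ 2 + 2 * p.1 - p.2 ^ 2, ?_⟩
    push_cast
    ring
  rw [siegelKernel_add_one, hq, mul_left_comm]

lemma Hhat_add_one {τ : ℂ} (hτ : 0 < τ.im) : Hhat (τ + 1) = zeta 3 * Hhat τ := by
  have him : (τ + 1).im = τ.im := by simp
  rw [Hhat_eq_integral (him ▸ hτ), Hhat_eq_integral hτ, him]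
  simp_rw [siegelTheta_add_one]
  rw [intervalIntegral.integral_const_mul, mul_left_comm]

lemma Hhat_mobius {τ : ℂ} (hτ : 0 < τ.im) :
    Hhat (τ / (2 * τ + 1)) = zeta 12 * (2 * τ + 1) * Hhat τ := by
  have h1 : 2 * τ + 1 ≠ 0 := fun h0 ↦ by
    have := congrArg im h0
    simp at this
    linarith
  have hn : 0 < ‖2 * τ + 1‖ := norm_pos_iff.mpr h1
  -- The square root of this contributes `1/|2τ+1|`, cancelling the non-holomorphic part of the
  -- automorphy factor.
  have him : (τ / (2 * τ + 1)).im = τ.im / ‖2 * τ + 1‖ ^ 2 := by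
    rw [div_im, ← normSq_eq_norm_sq]
    simp
    ring
  have hpos : 0 < (τ / (2 * τ + 1)).im := him ▸ by positivity
  rw [Hhat_eq_integral hpos, Hhat_eq_integral hτ, him, Real.sqrt_div hτ.le, Real.sqrt_sq hn.le]
  simp_rw [siegelTheta_mobius hτ]
  rw [intervalIntegral.integral_const_mul]
  have hn' : (‖2 * τ + 1‖ : ℂ) ≠ 0 := by exact_mod_cast hn.ne'
  push_cast
  field_simp

end HeckeCompletion

end

theorem mainTheorem2 (τ : ℂ) (hτ : 0 < τ.im) :
    (Summable (HeckeCompletion.heckeTerm (HeckeCompletion.qPow τ 1)) ∧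
      ∀ ε ∈ Finset.range 2, Summable (HeckeCompletion.minusTerm τ ε)) ∧
    HeckeCompletion.Hhat (τ + 1) = HeckeCompletion.zeta 3 * HeckeCompletion.Hhat τ ∧
    HeckeCompletion.Hhat (τ / (2 * τ + 1)) =
      HeckeCompletion.zeta 12 * (2 * τ + 1) * HeckeCompletion.Hhat τ :=
  ⟨⟨HeckeCompletion.summable_heckeTerm hτ, fun ε _ ↦ HeckeCompletion.summable_minusTerm hτ ε⟩,
    HeckeCompletion.Hhat_add_one hτ, HeckeCompletion.Hhat_mobius hτ⟩
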